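/- Let $d\in[0,1)$ and $\alpha>-d$. The law $\mathrm{PY}(d,\alpha)$ of a random sequence of weights $\boldsymbol\pi=(\pi_1,\pi_2,\dots)$ is given by stick breaking: $\pi_i=\beta_i\prod_{j<i}(1-\beta_j)$ with independent $\beta_i\sim\mathrm{Beta}(1-d,\alpha+id)$. For a family of weights write $H(\boldsymbol\pi)=-\sum_i\pi_i\log\pi_i$ (natural logarithm, $0\log 0=0$), and let $\psi_0=\Gamma'/\Gamma$ be the digamma function. (1) Let $\boldsymbol\pi\sim\mathrm{PY}(d,\alpha)$, let $\phi_1,\phi_2,\dots$ be i.i.d. with a non-atomic law $\nu$ on a standard Borel space $X$, independent of $\boldsymbol\pi$, and let $N\ge 1$ observations $\mathbf x=(x_1,\dots,x_N)$ be, conditionally on $(\boldsymbol\pi,\phi)$, i.i.d. with law $\sum_i\pi_i\delta_{\phi_i}$. Let $K$ be the number of distinct symbols in $\mathbf x$ and $n_1,\dots,n_K\ge 1$ the numbers of their occurrences, so that $\sum_i n_i=N$. Then the series $H(\boldsymbol\pi)$ converges almost surely, $H(\boldsymbol\pi)$ is integrable, and almost surely $$\mathbb E[H(\boldsymbol\pi)\mid\mathbf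 x]=\psi_0(\alpha+N+1)-\frac{\alpha+Kd}{\alpha+N}\,\psi_0(1-d)-\frac1{\alpha+N}\sum_{i=1}^K(n_i-d)\,\psi_0(n_i-d+1).$$ (2) For all $K\ge1$ and integers $n_1,\dots,n_K\ge1$ with sum $N$, let $(p_1,\dots,p_K,p_*)\sim\mathrm{Dir}(n_1-d,\dots,n_K-d,\alpha+Kd)$ and $\boldsymbol\pi'\sim\mathrm{PY}(d,\alpha+Kd)$ be independent, and put $\boldsymbol\pi_{\mathrm{post}}=(p_1,\dots,p_K,p_*\pi'_1,p_*\pi'_2,\dots)$. Then the series $H(\boldsymbol\pi_{\mathrm{post}})$ converges almost surely, $H(\boldsymbol\pi_{\mathrm{post}})$ is integrable, and $\mathbb E[H(\boldsymbol\pi_{\mathrm{post}})]$ equals the same expression. -/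

import Mathlib

open MeasureTheory ProbabilityTheory

noncomputable section

/-- The real digamma function `ψ₀ = Γ' / Γ`. -/
def psi0 (x : ℝ) : ℝ := logDeriv Real.Gamma x

/-- On the positive reals, `psi0` is the restriction of the complex digamma function. -/
theorem psi0_eq_digamma {x : ℝ} (hx : 0 < x) : (psi0 x : ℂ) = Complex.digamma x := by
  have hne : ∀ m : ℕ, x ≠ -m := fun m h => by
    have : (0 : ℝ) ≤ m := m.cast_nonneg
    linarith
  have hc : ∀ m : ℕ, (x : ℂ) ≠ -m := fun m h => hne m (by exact_mod_cast h)
  have h1 : HasDerivAt (fun y : ℝ => Complex.Gamma (y : ℂ)) (deriv Complex.Gamma x) x :=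
    (Complex.differentiableAt_Gamma _ hc).hasDerivAt.comp_ofReal
  have h2 : HasDerivAt (fun y : ℝ => ((Real.Gamma y : ℝ) : ℂ)) (deriv Real.Gamma x : ℝ) x :=
    (Real.differentiableAt_Gamma hne).hasDerivAt.ofReal_comp
  have h3 : deriv Complex.Gamma x = ((deriv Real.Gamma x : ℝ) : ℂ) := by
    refine h1.unique ?_
    simpa only [Complex.Gamma_ofReal] using h2
  rw [psi0, Complex.digamma_def, logDeriv_apply, logDeriv_apply, h3, Complex.Gamma_ofReal,
    Complex.ofReal_div]

/-- The Shannon entropy (in nats) `-∑ π_i log π_i` of a finite or countably infinite family of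
weights, with `0 log 0 = 0`. It is meaningful when the family of the terms is summable. -/
def entropy {ι : Type*} (π : ι → ℝ) : ℝ := ∑' i, Real.negMulLog (π i)

/-- Stick breaking: `π_i = β_i ∏_{j < i} (1 - β_j)`. -/
def stickBreak (β : ℕ → ℝ) (i : ℕ) : ℝ := (∏ j ∈ Finset.range i, (1 - β j)) * β i

/-- The Pitman-Yor law `PY(d, α)` of the random weights, by stick breaking with independent
`β_i ∼ Beta(1 - d, α + i d)`, `i = 1, 2, …` (the index `i = 0, 1, …` is shifted by one). -/
def pyMeasure (d α : ℝ) : Measure (ℕ → ℝ) :=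
  (Measure.infinitePi fun i : ℕ => betaMeasure (1 - d) (α + ((i : ℝ) + 1) * d)).map stickBreak

/-- The discrete random measure `∑_i π_i δ_{φ_i}` with weights `π` and atoms `φ`. -/
def discreteMeasure {X : Type*} [MeasurableSpace X] (π : ℕ → ℝ) (φ : ℕ → X) : Measure X :=
  Measure.sum fun i => ENNReal.ofReal (π i) • Measure.dirac (φ i)

/-- The Bayesian model with a Pitman-Yor prior and `N` observations, on a probability space
`(Ω, μ)`: the weights `π` have law `PY(d, α)`; the atoms `φ` are i.i.d. with law `ν` and
independent of `π`; given `(π, φ)`, the observations `x_1, …, x_N` are i.i.d. with law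
`∑_i π_i δ_{φ_i}`. -/
structure IsPYSample {Ω X : Type*} [MeasurableSpace Ω] [MeasurableSpace X] {N : ℕ}
    (d α : ℝ) (ν : Measure X) (π : Ω → ℕ → ℝ) (φ : Ω → ℕ → X) (x : Ω → Fin N → X)
    (μ : Measure Ω) : Prop where
  measurable_weights : Measurable π
  measurable_atoms : Measurable φ
  measurable_obs : Measurable x
  prior : μ.map (fun ω => (π ω, φ ω)) =
    (pyMeasure d α).prod (Measure.infinitePi fun _ : ℕ => ν)
  sampling : ∀ B : Fin N → Set X, (∀ j, MeasurableSet (B j)) →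
    μ⟦{ω | ∀ j, x ω j ∈ B j} | MeasurableSpace.comap (fun ω => (π ω, φ ω)) inferInstance⟧
      =ᵐ[μ] fun ω => ∏ j, (discreteMeasure (π ω) (φ ω)).real (B j)

open scoped Classical in
/-- The finite set of distinct symbols in a sample. -/
def observed {X : Type*} {N : ℕ} (x : Fin N → X) : Finset X := Finset.univ.image x

open scoped Classical in
/-- The number of times that the symbol `s` occurs in a sample. -/
def symbolCount {X : Type*} {N : ℕ} (x : Fin N → X) (s : X) : ℕ :=
  (Finset.univ.filter fun j => x j = s).card

/-- The Dirichlet distribution with positive parameters `a`: the law of `G / ∑_i G_i` for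
independent `G_i ∼ Gamma(a_i, 1)`. -/
def dirichletMeasure {ι : Type*} [Fintype ι] (a : ι → ℝ) : Measure (ι → ℝ) :=
  (Measure.pi fun i => gammaMeasure (a i) 1).map fun g i => g i / ∑ k, g k

/-- The law of `(p_1, …, p_K, p_* π_1, p_* π_2, …)`, where
`(p_1, …, p_K, p_*) ∼ Dir(n_1 - d, …, n_K - d, α + K d)` (the coordinate `p_*` has index `none`)
and `π ∼ PY(d, α + K d)` are independent. -/
def pyPosterior (d α : ℝ) {K : ℕ} (n : Fin K → ℕ) : Measure (Fin K ⊕ ℕ → ℝ) :=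
  ((dirichletMeasure fun o : Option (Fin K) => o.elim (α + K * d) fun i => (n i : ℝ) - d).prod
    (pyMeasure d (α + K * d))).map
      fun q => Sum.elim (fun i => q.1 (some i)) (fun j => q.1 none * q.2 j)

end

noncomputable section

open Filter Topology
open scoped ENNReal

/-! ### Moments of beta, gamma and Dirichlet laws -/

/-! The engine is one moment formula (`lintegral_injSum_pySticks`): for real exponents `a i ≥ 1`,
the expected sum of `∏ w (e i) ^ a i` over families `e` of distinct indices is the Gamma product
`pyMoment`, the Pitman-Yor partition probability extended to real block sizes. Both sides obey the
same affine recursion in `α`. Given the first stick `b`, the other weights are `1 - b` times `PY(d,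
α + d)` weights, and at most one of the distinct indices is the first one. By induction on the
number of blocks, the terms in which a block takes the first index agree, so the difference of the
two sides at `α + n d` is `c n` times the difference at `α + (n + 1) d`, with `0 ≤ c n ≤ 1 - ε / (n
+ 1)`. The differences are bounded and the product of the `c n` is zero, hence they vanish.

Real exponents are needed because entropy is a derivative: moving the exponent `1 + s` at `s = 0`
turns `w ^ (1 + s)` into `w log w` and a ratio of Gamma functions into a difference of digamma
functions (`lintegral_mul_negMulLog`, `hasDerivAt_Gamma_ratio`). In the product of the entropy with
a power sum, the index of an entropy term either belongs to a block already present or is new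
(`entropyENN_mul_injSum`). The two cases carry the predictive probabilities of an old and of a new
symbol, and they add up to `pyMoment * pyEntropyMean` (`lintegral_entropyENN_mul_injSum`).

For the conditional expectation, the joint law of weights and sample is a sum over index assignments
`z` of `∏ w (z j)` times the law of `φ ∘ z`. That law depends on `z` only through the partition it
induces, and since the atoms are almost surely distinct, the sample shows this partition. Grouping
the assignments by partition produces power sums over distinct indices whose exponents are the
counts (`IsPYSample.lintegral_mul`), and the conditional mean is the quotient of the entropy moment
by `pyMoment`.

The second claim does not pass through Bayes: it follows from the chain rule for entropy, the
Dirichlet moments and the prior mean entropy at `α + K d`. -/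

lemma ae_mem_Ioo_betaMeasure (p q : ℝ) : ∀ᵐ x ∂betaMeasure p q, x ∈ Set.Ioo (0 : ℝ) 1 := by
  rw [betaMeasure, ae_withDensity_iff (by unfold betaPDF; fun_prop)]
  refine ae_of_all _ fun x hx => ?_
  by_contra h
  exact hx (by rw [betaPDF_eq, if_neg (show ¬(0 < x ∧ x < 1) from h), ENNReal.ofReal_zero])

/-- The integrand times the `Beta(p, q)` density is a constant multiple of the `Beta(p + u, q + v)`
density. -/
lemma lintegral_betaMeasure_rpow {p q u v : ℝ} (hp : 0 < p) (hq : 0 < q) (hu : 0 ≤ u)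
    (hv : 0 ≤ v) :
    ∫⁻ x, ENNReal.ofReal x ^ u * ENNReal.ofReal (1 - x) ^ v ∂betaMeasure p q =
      ENNReal.ofReal (beta (p + u) (q + v) / beta p q) := by
  have hB := beta_pos hp hq
  have hB' := beta_pos (add_pos_of_pos_of_nonneg hp hu) (add_pos_of_pos_of_nonneg hq hv)
  have hm : Measurable (betaPDF p q) := by unfold betaPDF; fun_prop
  have hm' : Measurable (betaPDF (p + u) (q + v)) := by unfold betaPDF; fun_prop
  rw [betaMeasure, lintegral_withDensity_eq_lintegral_mul _ hm (by fun_prop)]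
  have : ∀ x, (betaPDF p q * fun x => ENNReal.ofReal x ^ u * ENNReal.ofReal (1 - x) ^ v) x =
      ENNReal.ofReal (beta (p + u) (q + v) / beta p q) * betaPDF (p + u) (q + v) x := by
    intro x
    simp only [Pi.mul_apply, betaPDF_eq]
    split_ifs with h
    · have h1 : 0 < 1 - x := by linarith [h.2]
      rw [ENNReal.ofReal_rpow_of_pos h.1, ENNReal.ofReal_rpow_of_pos h1,
        ← ENNReal.ofReal_mul (Real.rpow_nonneg h.1.le _),
        ← ENNReal.ofReal_mul' (mul_nonneg (Real.rpow_nonneg h.1.le _) (Real.rpow_nonneg h1.le _)),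
        ← ENNReal.ofReal_mul (div_pos hB' hB).le]
      congr 1
      rw [show p + u - 1 = p - 1 + u by ring, show q + v - 1 = q - 1 + v by ring,
        Real.rpow_add h.1, Real.rpow_add h1]
      field_simp
    · simp
  simp_rw [this]
  rw [lintegral_const_mul _ hm', lintegral_betaPDF_eq_one (by linarith) (by linarith), mul_one]

lemma ae_pos_gammaMeasure (a : ℝ) : ∀ᵐ x ∂gammaMeasure a 1, 0 < x := by
  have hm : Measurable (gammaPDF a 1) := by unfold gammaPDF; fun_prop
  rw [gammaMeasure, ae_withDensity_iff hm]
  have h0 : ∀ᵐ x : ℝ, x ≠ 0 := by simp [ae_iff]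
  filter_upwards [h0] with x hx hpdf
  by_contra h
  exact hpdf (gammaPDF_of_neg (lt_of_le_of_ne (not_lt.1 h) hx))

/-- The integrand tilts the density into that of `Gamma(a + t, 1 + u)`. The exponential factor
serves to decouple the normalisation of a Dirichlet vector. -/
lemma lintegral_gammaMeasure_rpow_mul_exp {a t u : ℝ} (ha : 0 < a) (ht : 0 ≤ t) (hu : 0 ≤ u) :
    ∫⁻ x, ENNReal.ofReal x ^ t * ENNReal.ofReal (Real.exp (-(u * x))) ∂gammaMeasure a 1 =
      ENNReal.ofReal (Real.Gamma (a + t) / Real.Gamma a * (1 + u) ^ (-(a + t))) := by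
  have hm : Measurable (gammaPDF a 1) := by unfold gammaPDF; fun_prop
  have hm' : Measurable (gammaPDF (a + t) (1 + u)) := by unfold gammaPDF; fun_prop
  have hG := Real.Gamma_pos_of_pos ha
  have hG' := Real.Gamma_pos_of_pos (add_pos_of_pos_of_nonneg ha ht)
  have hu1 : 0 < 1 + u := by linarith
  have hr : 0 < (1 + u) ^ (-(a + t)) := Real.rpow_pos_of_pos hu1 _
  rw [gammaMeasure, lintegral_withDensity_eq_lintegral_mul _ hm (by fun_prop)]
  have : ∀ᵐ x : ℝ, (gammaPDF a 1 * fun x => ENNReal.ofReal x ^ t *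
      ENNReal.ofReal (Real.exp (-(u * x)))) x =
      ENNReal.ofReal (Real.Gamma (a + t) / Real.Gamma a * (1 + u) ^ (-(a + t))) *
        gammaPDF (a + t) (1 + u) x := by
    have h0 : ∀ᵐ x : ℝ, x ≠ 0 := by simp [ae_iff]
    filter_upwards [h0] with x hx
    rcases lt_or_gt_of_ne hx with h | h
    · simp [gammaPDF_of_neg h]
    · simp only [Pi.mul_apply]
      rw [gammaPDF_of_nonneg h.le, gammaPDF_of_nonneg h.le, ENNReal.ofReal_rpow_of_pos h,
        ← ENNReal.ofReal_mul (Real.rpow_nonneg h.le _),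
        ← ENNReal.ofReal_mul' (mul_nonneg (Real.rpow_nonneg h.le _) (Real.exp_pos _).le),
        ← ENNReal.ofReal_mul (mul_pos (div_pos hG' hG) hr).le]
      congr 1
      rw [show a + t - 1 = a - 1 + t by ring, Real.rpow_add h, Real.rpow_neg hu1.le,
        show -((1 + u) * x) = -(1 * x) + -(u * x) by ring, Real.exp_add, Real.one_rpow]
      have := (Real.rpow_pos_of_pos hu1 (a + t)).ne'
      field_simp
  rw [lintegral_congr_ae this, lintegral_const_mul _ hm',
    lintegral_gammaPDF_eq_one (by linarith) hu1, mul_one]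

/-- `∫₀^∞ u^(t-1) e^(-u S) du = Γ(t) / S^t`. -/
lemma lintegral_rpow_mul_exp_neg {t S : ℝ} (ht : 0 < t) (hS : 0 < S) :
    ∫⁻ u in Set.Ioi (0 : ℝ), ENNReal.ofReal (u ^ (t - 1)) * ENNReal.ofReal (Real.exp (-(u * S))) =
      ENNReal.ofReal (Real.Gamma t) * ENNReal.ofReal (1 / S) ^ t := by
  have h := Real.integral_rpow_mul_exp_neg_mul_Ioi ht hS
  have hpos : 0 < Real.Gamma t := Real.Gamma_pos_of_pos ht
  have hint : Integrable (fun u : ℝ => u ^ (t - 1) * Real.exp (-(S * u)))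
      (volume.restrict (Set.Ioi 0)) := by
    by_contra hn
    rw [integral_undef hn] at h
    exact absurd h (mul_pos (Real.rpow_pos_of_pos (by positivity) _) hpos).ne
  rw [ENNReal.ofReal_rpow_of_pos (by positivity), ← ENNReal.ofReal_mul hpos.le,
    mul_comm (Real.Gamma t), ← h, ofReal_integral_eq_lintegral_ofReal hint]
  · refine setLIntegral_congr_fun measurableSet_Ioi fun u hu => ?_
    rw [← ENNReal.ofReal_mul (Real.rpow_nonneg (le_of_lt hu) _), mul_comm u S]
  · filter_upwards [ae_restrict_mem measurableSet_Ioi] with u hu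
    exact mul_nonneg (Real.rpow_nonneg (le_of_lt hu) _) (Real.exp_pos _).le

lemma lintegral_pi_prod {ι : Type*} [Fintype ι] {E : ι → Type*} [∀ i, MeasurableSpace (E i)]
    (μ : ∀ i, Measure (E i)) [∀ i, IsProbabilityMeasure (μ i)] {f : ∀ i, E i → ℝ≥0∞}
    (hf : ∀ i, Measurable (f i)) :
    ∫⁻ g, ∏ i, f i (g i) ∂Measure.pi μ = ∏ i, ∫⁻ x, f i x ∂μ i := by
  refine (lintegral_prod_eq_prod_lintegral_of_indepFun Finset.univ
    (fun i (g : ∀ i, E i) => f i (g i))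
    (iIndepFun_pi fun i => (hf i).aemeasurable)
    (fun i => (hf i).comp (measurable_pi_apply i))).trans ?_
  refine Finset.prod_congr rfl fun i _ => ?_
  rw [← lintegral_map (hf i) (measurable_pi_apply i), (measurePreserving_eval μ i).map_eq]

lemma ae_pos_pi_gammaMeasure {ι : Type*} [Fintype ι] {a : ι → ℝ} (ha : ∀ i, 0 < a i) :
    ∀ᵐ g ∂Measure.pi (fun i => gammaMeasure (a i) 1), ∀ i, 0 < g i := by
  have : ∀ i, IsProbabilityMeasure (gammaMeasure (a i) 1) :=
    fun i => isProbabilityMeasure_gammaMeasure (ha i) one_pos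
  rw [ae_all_iff]
  intro i
  exact (Measure.quasiMeasurePreserving_eval (μ := fun i => gammaMeasure (a i) 1) i).ae
    (ae_pos_gammaMeasure (a i))

/-- Writing `Γ(t) / S ^ t` as `∫ u ^ (t - 1) e ^ (-u S) du` with `S = ∑ g i` makes the integrand a
product over independent coordinates. The remaining `u`-integral depends on `a` only through `∑ a
i`, so it need not be computed here. -/
lemma lintegral_gamma_ratio_aux {ι : Type*} [Fintype ι] {a : ι → ℝ} (ha : ∀ i, 0 < a i) (k : ι)
    {t : ℝ} (ht : 0 < t) :
    ENNReal.ofReal (Real.Gamma t) *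
        ∫⁻ g, ENNReal.ofReal (g k / ∑ i, g i) ^ t ∂Measure.pi (fun i => gammaMeasure (a i) 1) =
      ENNReal.ofReal (Real.Gamma (a k + t) / Real.Gamma (a k)) *
        ∫⁻ u in Set.Ioi (0 : ℝ), ENNReal.ofReal (u ^ (t - 1) * (1 + u) ^ (-(∑ i, a i + t))) := by
  classical
  have : ∀ i, IsProbabilityMeasure (gammaMeasure (a i) 1) :=
    fun i => isProbabilityMeasure_gammaMeasure (ha i) one_pos
  rw [← lintegral_const_mul _ (by fun_prop)]
  -- The power `t` is placed on coordinate `k` alone, so that all coordinates can be treated by the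
  -- same product formula.
  let τ : ι → ℝ := fun i => if i = k then t else 0
  have hτ : ∀ i, 0 ≤ τ i := fun i => by simp only [τ]; split_ifs <;> linarith
  have hτsum : ∑ i, τ i = t := by simp [τ]
  have hmeas : Measurable fun q : (ι → ℝ) × ℝ => ENNReal.ofReal (q.2 ^ (t - 1)) *
      ∏ i, (ENNReal.ofReal (q.1 i) ^ τ i * ENNReal.ofReal (Real.exp (-(q.2 * q.1 i)))) := by
    refine Measurable.mul (by fun_prop) (Finset.measurable_prod _ fun i _ => ?_)
    have h1 : Measurable fun q : (ι → ℝ) × ℝ => q.1 i := by fun_prop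
    exact (h1.ennreal_ofReal.pow_const _).mul
      (Real.measurable_exp.comp (measurable_snd.mul h1).neg).ennreal_ofReal
  have h1 : ∀ᵐ g ∂Measure.pi (fun i => gammaMeasure (a i) 1),
      ENNReal.ofReal (Real.Gamma t) * ENNReal.ofReal (g k / ∑ i, g i) ^ t =
      ∫⁻ u in Set.Ioi (0 : ℝ), ENNReal.ofReal (u ^ (t - 1)) *
        ∏ i, (ENNReal.ofReal (g i) ^ τ i * ENNReal.ofReal (Real.exp (-(u * g i)))) := by
    filter_upwards [ae_pos_pi_gammaMeasure ha] with g hg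
    have hS : 0 < ∑ i, g i := Finset.sum_pos (fun i _ => hg i) ⟨k, Finset.mem_univ k⟩
    have : ∀ u : ℝ, ENNReal.ofReal (u ^ (t - 1)) *
        ∏ i, (ENNReal.ofReal (g i) ^ τ i * ENNReal.ofReal (Real.exp (-(u * g i)))) =
        ENNReal.ofReal (g k) ^ t * (ENNReal.ofReal (u ^ (t - 1)) *
          ENNReal.ofReal (Real.exp (-(u * ∑ i, g i)))) := by
      intro u
      have hk : ∏ i, ENNReal.ofReal (g i) ^ τ i = ENNReal.ofReal (g k) ^ t := by
        rw [Finset.prod_eq_single k (fun i _ hi => by simp [τ, hi]) (by simp)]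
        simp [τ]
      rw [Finset.prod_mul_distrib, hk,
        ← ENNReal.ofReal_prod_of_nonneg (fun i _ => (Real.exp_pos _).le), ← Real.exp_sum,
        Finset.sum_neg_distrib, Finset.mul_sum]
      ring
    simp_rw [this]
    rw [lintegral_const_mul _ (by fun_prop), lintegral_rpow_mul_exp_neg ht hS, div_eq_mul_one_div,
      ENNReal.ofReal_mul (hg k).le, ENNReal.mul_rpow_of_nonneg _ _ ht.le]
    ring
  rw [lintegral_congr_ae h1, lintegral_lintegral_swap hmeas.aemeasurable,
    ← lintegral_const_mul _ (by fun_prop)]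
  refine setLIntegral_congr_fun measurableSet_Ioi fun u hu => ?_
  have hu0 : 0 < u := hu
  have hu1 : 0 < 1 + u := by linarith
  have hΓ : ∀ i, 0 < Real.Gamma (a i) := fun i => Real.Gamma_pos_of_pos (ha i)
  have hΓ' : ∀ i, 0 < Real.Gamma (a i + τ i) := fun i =>
    Real.Gamma_pos_of_pos (add_pos_of_pos_of_nonneg (ha i) (hτ i))
  have hprod := lintegral_pi_prod (fun i => gammaMeasure (a i) 1)
    (f := fun i x => ENNReal.ofReal x ^ τ i * ENNReal.ofReal (Real.exp (-(u * x))))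
    (fun i => by fun_prop)
  have hmeas' : Measurable fun g : ι → ℝ =>
      ∏ i, (ENNReal.ofReal (g i) ^ τ i * ENNReal.ofReal (Real.exp (-(u * g i)))) := by
    refine Finset.measurable_prod _ fun i _ => ?_
    have h1 : Measurable fun q : ι → ℝ => q i := by fun_prop
    exact (h1.ennreal_ofReal.pow_const _).mul
      (Real.measurable_exp.comp (measurable_const.mul h1).neg).ennreal_ofReal
  rw [lintegral_const_mul _ hmeas', hprod]
  simp_rw [fun i => lintegral_gammaMeasure_rpow_mul_exp (ha i) (hτ i) hu0.le]
  rw [← ENNReal.ofReal_prod_of_nonneg fun i _ =>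
      mul_nonneg (div_pos (hΓ' i) (hΓ i)).le (Real.rpow_nonneg hu1.le _),
    ← ENNReal.ofReal_mul (Real.rpow_nonneg hu0.le _),
    ← ENNReal.ofReal_mul (by simpa [τ] using (div_pos (hΓ' k) (hΓ k)).le)]
  congr 1
  have hk : ∏ i, Real.Gamma (a i + τ i) / Real.Gamma (a i) =
      Real.Gamma (a k + t) / Real.Gamma (a k) := by
    rw [Finset.prod_eq_single k (fun i _ hi => by simp [τ, hi, (hΓ i).ne']) (by simp)]
    simp [τ]
  rw [Finset.prod_mul_distrib, hk, ← Real.rpow_sum_of_pos hu1, Finset.sum_neg_distrib,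
    Finset.sum_add_distrib, hτsum]
  ring

/-- Moments of the coordinates of a Dirichlet vector. -/
lemma lintegral_dirichletMeasure_rpow {ι : Type*} [Fintype ι] {a : ι → ℝ} (ha : ∀ i, 0 < a i)
    (k : ι) {t : ℝ} (ht : 0 < t) :
    ∫⁻ p, ENNReal.ofReal (p k) ^ t ∂dirichletMeasure a =
      ENNReal.ofReal (Real.Gamma (a k + t) * Real.Gamma (∑ i, a i) /
        (Real.Gamma (a k) * Real.Gamma (∑ i, a i + t))) := by
  have hmeas : Measurable fun (g : ι → ℝ) i => g i / ∑ k, g k := by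
    rw [measurable_pi_iff]; intro i; fun_prop
  rw [dirichletMeasure, lintegral_map (by fun_prop) hmeas]
  have hA : 0 < ∑ i, a i := Finset.sum_pos (fun i _ => ha i) ⟨k, Finset.mem_univ k⟩
  have h1 := lintegral_gamma_ratio_aux ha k ht
  -- With a single coordinate of parameter `∑ a i` the ratio is identically `1`; this evaluates the
  -- `u`-integral.
  have h2 := lintegral_gamma_ratio_aux (a := fun _ : Unit => ∑ i, a i) (fun _ => hA) () ht
  have : IsProbabilityMeasure (gammaMeasure (∑ i, a i) 1) :=
    isProbabilityMeasure_gammaMeasure hA one_pos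
  have h3 : ∫⁻ g : Unit → ℝ, ENNReal.ofReal (g () / ∑ i, g i) ^ t
      ∂Measure.pi (fun _ => gammaMeasure (∑ i, a i) 1) = 1 := by
    rw [lintegral_congr_ae (g := fun _ => 1)]
    · simp
    · filter_upwards [ae_pos_pi_gammaMeasure (a := fun _ : Unit => ∑ i, a i) (fun _ => hA)]
        with g hg
      simp [div_self (hg ()).ne']
  rw [h3, mul_one, Finset.univ_unique (α := Unit), Finset.sum_singleton] at h2
  have hΓt := Real.Gamma_pos_of_pos ht
  have hΓA := Real.Gamma_pos_of_pos hA
  have hΓAt := Real.Gamma_pos_of_pos (add_pos hA ht)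
  have hΓk := Real.Gamma_pos_of_pos (ha k)
  have hΓkt := Real.Gamma_pos_of_pos (add_pos (ha k) ht)
  have hne : ∀ {x : ℝ}, 0 < x → ENNReal.ofReal x ≠ 0 := fun h => by simpa using h
  have h4 : ∫⁻ u in Set.Ioi (0 : ℝ), ENNReal.ofReal (u ^ (t - 1) * (1 + u) ^ (-(∑ i, a i + t))) =
      ENNReal.ofReal (Real.Gamma t * Real.Gamma (∑ i, a i) / Real.Gamma (∑ i, a i + t)) := by
    rw [← ENNReal.mul_right_inj (hne (div_pos hΓAt hΓA)) ENNReal.ofReal_ne_top, ← h2,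
      ← ENNReal.ofReal_mul (div_pos hΓAt hΓA).le]
    congr 1
    field_simp
  rw [h4] at h1
  rw [← ENNReal.mul_right_inj (hne hΓt) ENNReal.ofReal_ne_top, h1,
    ← ENNReal.ofReal_mul (div_pos hΓkt hΓk).le, ← ENNReal.ofReal_mul hΓt.le]
  congr 1
  field_simp

/-! ### Logarithmic moments from power moments -/

/-- If `w p^(1+s)` has integral `m s` for small `s ≥ 0`, then `-w p log p` has integral `-m' 0`. -/
lemma lintegral_mul_negMulLog {T : Type*} [MeasurableSpace T] {τ : Measure T} {w : T → ℝ≥0∞}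
    (hw : Measurable w) {p : T → ℝ} (hp : Measurable p) (hp01 : ∀ᵐ x ∂τ, p x ∈ Set.Icc (0 : ℝ) 1)
    {m : ℝ → ℝ} {m' : ℝ} (hm : HasDerivAt m m' 0) (hm0 : ∀ s ∈ Set.Icc (0 : ℝ) 1, 0 ≤ m s)
    (h : ∀ s ∈ Set.Icc (0 : ℝ) 1,
      ∫⁻ x, w x * ENNReal.ofReal (p x) ^ (1 + s) ∂τ = ENNReal.ofReal (m s)) :
    m' ≤ 0 ∧ ∫⁻ x, w x * ENNReal.ofReal (Real.negMulLog (p x)) ∂τ = ENNReal.ofReal (-m') := by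
  let s : ℕ → ℝ := fun n => 1 / ((n : ℝ) + 1)
  have hs0 : ∀ n, 0 < s n := fun n => by positivity
  have hs1 : ∀ n, s n ≤ 1 := fun n => by
    simp only [s]; rw [div_le_one (by positivity)]; linarith [(n.cast_nonneg : (0 : ℝ) ≤ n)]
  have hslim : Tendsto s atTop (𝓝 0) := tendsto_one_div_add_atTop_nhds_zero_nat
  have hslim' : Tendsto s atTop (𝓝[≠] 0) :=
    tendsto_nhdsWithin_iff.2 ⟨hslim, Eventually.of_forall fun n => (hs0 n).ne'⟩
  -- Up to sign, the difference quotients at `0` of `s ↦ w p ^ (1 + s)`, along `s n = 1 / (n + 1)`.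
  let F : ℕ → T → ℝ≥0∞ := fun n x => w x * ENNReal.ofReal ((p x - p x ^ (1 + s n)) / s n)
  have hFmeas : ∀ n, Measurable (F n) := fun n => by simp only [F]; fun_prop
  have hle : ∀ n, ∀ q ∈ Set.Icc (0 : ℝ) 1, q ^ (1 + s n) ≤ q := fun n q hq => by
    simpa using Real.rpow_le_rpow_of_exponent_ge' hq.1 hq.2 zero_le_one
      (by linarith [hs0 n] : (1 : ℝ) ≤ 1 + s n)
  have hI : ∀ n, ∫⁻ x, F n x ∂τ = ENNReal.ofReal ((m 0 - m (s n)) / s n) := by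
    intro n
    have h0 := h 0 ⟨le_rfl, zero_le_one⟩
    have hn := h (s n) ⟨(hs0 n).le, hs1 n⟩
    have e1 : ∫⁻ x, w x * ENNReal.ofReal (p x) ^ (1 + (0 : ℝ)) ∂τ =
        ∫⁻ x, w x * ENNReal.ofReal (p x - p x ^ (1 + s n)) ∂τ +
          ∫⁻ x, w x * ENNReal.ofReal (p x) ^ (1 + s n) ∂τ := by
      rw [← lintegral_add_left (by fun_prop)]
      refine lintegral_congr_ae ?_
      filter_upwards [hp01] with x hx
      rw [add_zero, ENNReal.rpow_one, ENNReal.ofReal_rpow_of_nonneg hx.1 (by linarith [hs0 n]),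
        ← mul_add, ← ENNReal.ofReal_add (by linarith [hle n _ hx]) (Real.rpow_nonneg hx.1 _)]
      simp
    rw [h0, hn] at e1
    have e2 : ∫⁻ x, w x * ENNReal.ofReal (p x - p x ^ (1 + s n)) ∂τ =
        ENNReal.ofReal (m 0 - m (s n)) := by
      rw [ENNReal.ofReal_sub _ (hm0 _ ⟨(hs0 n).le, hs1 n⟩), e1,
        ENNReal.add_sub_cancel_right ENNReal.ofReal_ne_top]
    have e3 : ∀ x, F n x = ENNReal.ofReal (1 / s n) *
        (w x * ENNReal.ofReal (p x - p x ^ (1 + s n))) := by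
      intro x
      simp only [F]
      rw [div_eq_inv_mul, ENNReal.ofReal_mul (inv_pos.2 (hs0 n)).le, one_div]
      ring
    simp_rw [e3]
    rw [lintegral_const_mul _ (by fun_prop), e2, ← ENNReal.ofReal_mul (one_div_pos.2 (hs0 n)).le]
    congr 1
    ring
  have hlim : Tendsto (fun n => (m 0 - m (s n)) / s n) atTop (𝓝 (-m')) := by
    have := (hm.tendsto_slope.comp hslim').neg
    refine this.congr fun n => ?_
    simp only [Function.comp, slope_def_field]
    ring
  have hmono : ∀ n, 0 ≤ (m 0 - m (s n)) / s n := by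
    intro n
    refine div_nonneg ?_ (hs0 n).le
    have h0 := h 0 ⟨le_rfl, zero_le_one⟩
    have hn := h (s n) ⟨(hs0 n).le, hs1 n⟩
    have : ENNReal.ofReal (m (s n)) ≤ ENNReal.ofReal (m 0) := by
      rw [← h0, ← hn]
      refine lintegral_mono_ae ?_
      filter_upwards [hp01] with x hx
      refine mul_le_mul_right ?_ _
      rw [ENNReal.ofReal_rpow_of_nonneg hx.1 (by linarith [hs0 n]), add_zero, ENNReal.rpow_one]
      exact ENNReal.ofReal_le_ofReal (hle n _ hx)
    linarith [(ENNReal.ofReal_le_ofReal_iff (hm0 0 ⟨le_rfl, zero_le_one⟩)).1 this]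
  refine ⟨by linarith [ge_of_tendsto' hlim hmono], ?_⟩
  have hlim' := (ENNReal.continuous_ofReal.tendsto _).comp hlim
  have hFlim : ∀ᵐ x ∂τ, Tendsto (fun n => F n x) atTop
      (𝓝 (w x * ENNReal.ofReal (Real.negMulLog (p x)))) := by
    -- The weight may be infinite where `p = 0`; where `p > 0`, finiteness of the moment at `s = 0`
    -- excludes this almost everywhere.
    have hfin : ∀ᵐ x ∂τ, w x * ENNReal.ofReal (p x) ^ (1 + (0 : ℝ)) < ∞ :=
      ae_lt_top (by fun_prop) (by rw [h 0 ⟨le_rfl, zero_le_one⟩]; exact ENNReal.ofReal_ne_top)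
    filter_upwards [hp01, hfin] with x hx hfx
    rcases eq_or_lt_of_le hx.1 with h0 | h0
    · have : ∀ n, F n x = 0 := fun n => by
        simp only [F]
        rw [← h0, Real.zero_rpow (by linarith [hs0 n])]
        simp
      simp [this, ← h0]
    · have hwx : w x ≠ ∞ := by
        intro hwx
        rw [hwx, ENNReal.top_mul (by simpa using h0)] at hfx
        exact lt_irrefl _ hfx
      refine ENNReal.Tendsto.const_mul ((ENNReal.continuous_ofReal.tendsto _).comp ?_)
        (Or.inr hwx)
      have hd : HasDerivAt (fun y : ℝ => p x ^ (1 + y)) (p x * Real.log (p x)) 0 := by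
        have := ((hasDerivAt_id (0 : ℝ)).const_add 1).const_rpow h0
        simpa [mul_comm] using this
      have := (hd.tendsto_slope.comp hslim').neg
      rw [Real.negMulLog, neg_mul]
      refine this.congr fun n => ?_
      simp only [Function.comp, slope_def_field]
      simp
      ring
  -- Fatou's lemma gives the upper bound. The lower bound holds for each `n` separately, because `e
  -- ^ y ≥ 1 + y` bounds the difference quotient by `-p log p`.
  refine le_antisymm ?_ ?_
  · calc ∫⁻ x, w x * ENNReal.ofReal (Real.negMulLog (p x)) ∂τ
        = ∫⁻ x, liminf (fun n => F n x) atTop ∂τ := by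
          refine lintegral_congr_ae ?_
          filter_upwards [hFlim] with x hx using hx.liminf_eq.symm
      _ ≤ liminf (fun n => ∫⁻ x, F n x ∂τ) atTop := lintegral_liminf_le hFmeas
      _ = ENNReal.ofReal (-m') := by
          simp_rw [hI]
          exact hlim'.liminf_eq
  · refine le_of_tendsto' hlim' fun n => ?_
    simp only [Function.comp]
    rw [← hI]
    refine lintegral_mono_ae ?_
    filter_upwards [hp01] with x hx
    simp only [F]
    refine mul_le_mul_right (ENNReal.ofReal_le_ofReal ?_) _
    rcases eq_or_lt_of_le hx.1 with h0 | h0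
    · rw [← h0, Real.zero_rpow (by linarith [hs0 n])]; simp
    · rw [div_le_iff₀ (hs0 n), Real.negMulLog, Real.rpow_add h0, Real.rpow_one,
        Real.rpow_def_of_pos h0]
      nlinarith [Real.add_one_le_exp (Real.log (p x) * s n)]

/-- The version of `lintegral_mul_negMulLog` for countable sums of integrals. -/
lemma tsum_lintegral_mul_negMulLog {κ T : Type*} [Countable κ] [MeasurableSpace T] {P : Measure T}
    {w : κ → T → ℝ≥0∞} (hw : ∀ e, Measurable (w e)) {p : κ → T → ℝ} (hp : ∀ e, Measurable (p e))
    (hp01 : ∀ e, ∀ᵐ x ∂P, p e x ∈ Set.Icc (0 : ℝ) 1)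
    {m : ℝ → ℝ} {m' : ℝ} (hm : HasDerivAt m m' 0) (hm0 : ∀ s ∈ Set.Icc (0 : ℝ) 1, 0 ≤ m s)
    (h : ∀ s ∈ Set.Icc (0 : ℝ) 1,
      ∑' e, ∫⁻ x, w e x * ENNReal.ofReal (p e x) ^ (1 + s) ∂P = ENNReal.ofReal (m s)) :
    m' ≤ 0 ∧ ∑' e, ∫⁻ x, w e x * ENNReal.ofReal (Real.negMulLog (p e x)) ∂P =
      ENNReal.ofReal (-m') := by
  let _ : MeasurableSpace κ := ⊤
  have hW : Measurable fun y : κ × T => w y.1 y.2 := measurable_from_prod_countable_right hw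
  have hp' : Measurable fun y : κ × T => p y.1 y.2 := measurable_from_prod_countable_right hp
  -- The sum of integrals is a single integral over the disjoint union of copies of `T`, to which
  -- the previous statement applies.
  let τ : Measure (κ × T) := Measure.sum fun e => P.map fun x => (e, x)
  have hτ : ∀ f : κ × T → ℝ≥0∞, Measurable f → ∫⁻ y, f y ∂τ = ∑' e, ∫⁻ x, f (e, x) ∂P :=
    fun f hf => by
      simp only [τ]
      rw [lintegral_sum_measure]
      exact tsum_congr fun e => lintegral_map hf measurable_prodMk_left
  have key := lintegral_mul_negMulLog (τ := τ) hW hp' (by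
    simp only [τ]
    rw [Measure.ae_sum_iff]
    intro e
    rw [ae_map_iff measurable_prodMk_left.aemeasurable (hp' measurableSet_Icc)]
    exact hp01 e) hm hm0 (fun s hs => by rw [hτ _ (by fun_prop)]; exact h s hs)
  rw [hτ _ (by fun_prop)] at key
  exact key

/-! ### Power sums over distinct indices -/

lemma ENNReal.tsum_pi_prod_fin {κ : Type*} {N : ℕ} (f : Fin N → κ → ℝ≥0∞) :
    ∑' z : Fin N → κ, ∏ i, f i (z i) = ∏ i, ∑' m, f i m := by
  induction N with
  | zero => simp
  | succ N ih =>
    rw [Fin.prod_univ_succ, ← ih,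
      ← (Fin.consEquiv fun _ : Fin (N + 1) => κ).tsum_eq (fun z => ∏ i, f i (z i)),
      ENNReal.tsum_prod', ← ENNReal.tsum_mul_right]
    refine tsum_congr fun m => ?_
    rw [← ENNReal.tsum_mul_left]
    refine tsum_congr fun z => ?_
    simp [Fin.prod_univ_succ, Fin.consEquiv]

lemma ENNReal.tsum_pi_prod {ι κ : Type*} [Fintype ι] (f : ι → κ → ℝ≥0∞) :
    ∑' z : ι → κ, ∏ i, f i (z i) = ∏ i, ∑' m, f i m := by
  have e := Fintype.equivFin ι
  rw [← e.symm.prod_comp, ← ENNReal.tsum_pi_prod_fin, ← (e.arrowCongr (Equiv.refl κ)).tsum_eq]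
  refine tsum_congr fun z => ?_
  rw [← e.symm.prod_comp]
  simp

/-- The sum of `∏ i, w (e i) ^ a i` over the families `e` of distinct indices. -/
def injSum {ι : Type*} [Fintype ι] (w : ℕ → ℝ≥0∞) (a : ι → ℝ) : ℝ≥0∞ :=
  ∑' e : ι ↪ ℕ, ∏ i, w (e i) ^ a i

lemma measurable_injSum {ι T : Type*} [Fintype ι] [MeasurableSpace T] {w : T → ℕ → ℝ≥0∞}
    (hw : ∀ j, Measurable fun t => w t j) (a : ι → ℝ) : Measurable fun t => injSum (w t) a :=
  have : Countable (ι ↪ ℕ) := DFunLike.coe_injective.countable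
  Measurable.tsum fun e => Finset.measurable_prod _ fun i _ => (hw (e i)).pow_const _

lemma injSum_mul {ι : Type*} [Fintype ι] (c : ℝ≥0∞) (w : ℕ → ℝ≥0∞) {a : ι → ℝ}
    (ha : ∀ i, 0 ≤ a i) : injSum (fun j => c * w j) a = c ^ (∑ i, a i) * injSum w a := by
  rw [injSum, injSum, ← ENNReal.tsum_mul_left]
  refine tsum_congr fun e => ?_
  simp_rw [fun i => ENNReal.mul_rpow_of_nonneg c (w (e i)) (ha i)]
  rw [Finset.prod_mul_distrib]
  congr 1
  classical
  induction (Finset.univ : Finset ι) using Finset.induction_on with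
  | empty => simp
  | insert i s hi ih =>
    rw [Finset.prod_insert hi, Finset.sum_insert hi, ih,
      ENNReal.rpow_add_of_nonneg _ _ (ha i) (Finset.sum_nonneg fun j _ => ha j)]

/-- Dropping the distinctness of the indices only enlarges the sum, which then factors. This
provides the boundedness in the uniqueness argument for the recursion. -/
lemma injSum_le_one {ι : Type*} [Fintype ι] {w : ℕ → ℝ≥0∞} (hw : ∑' j, w j ≤ 1) {a : ι → ℝ}
    (ha : ∀ i, 1 ≤ a i) : injSum w a ≤ 1 := by
  calc injSum w a ≤ ∑' z : ι → ℕ, ∏ i, w (z i) ^ a i :=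
        ENNReal.tsum_comp_le_tsum_of_injective DFunLike.coe_injective
          (fun z : ι → ℕ => ∏ i, w (z i) ^ a i)
    _ = ∏ i, ∑' j, w j ^ a i := ENNReal.tsum_pi_prod fun i j => w j ^ a i
    _ ≤ ∏ _i : ι, 1 := by
        refine Finset.prod_le_prod' fun i _ => le_trans (ENNReal.tsum_le_tsum fun j => ?_) hw
        simpa using ENNReal.rpow_le_rpow_of_exponent_ge ((ENNReal.le_tsum j).trans hw) (ha i)
    _ = 1 := by simp

/-- A family of distinct indices either avoids `0` or takes the value `0` exactly once. -/
def embeddingNatCons (ι : Type*) [DecidableEq ι] :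
    (ι ↪ ℕ) ⊕ (Σ k : ι, ({i // i ≠ k} ↪ ℕ)) → (ι ↪ ℕ)
  | .inl e => ⟨fun i => e i + 1, fun i j h => e.injective (by simpa using h)⟩
  | .inr ⟨k, e⟩ => ⟨fun i => if h : i = k then 0 else e ⟨i, h⟩ + 1, fun i j h => by
      by_cases hi : i = k <;> by_cases hj : j = k
      · rw [hi, hj]
      · simp [hi, hj] at h
      · simp [hi, hj] at h
      · simpa [hi, hj] using h⟩

lemma embeddingNatCons_inl {ι : Type*} [DecidableEq ι] (e : ι ↪ ℕ) (i : ι) :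
    embeddingNatCons ι (.inl e) i = e i + 1 := rfl

lemma embeddingNatCons_inr {ι : Type*} [DecidableEq ι] (k : ι) (e : {i // i ≠ k} ↪ ℕ) (i : ι) :
    embeddingNatCons ι (.inr ⟨k, e⟩) i = if h : i = k then 0 else e ⟨i, h⟩ + 1 := rfl

lemma embeddingNatCons_bijective (ι : Type*) [DecidableEq ι] :
    Function.Bijective (embeddingNatCons ι) := by
  constructor
  · rintro (e | ⟨k, e⟩) (e' | ⟨k', e'⟩) h
    · have h' := fun i => DFunLike.congr_fun h i
      refine congrArg _ (DFunLike.ext _ _ fun i => ?_)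
      simpa [embeddingNatCons_inl, embeddingNatCons_inr] using h' i
    · have := DFunLike.congr_fun h k'
      simp [embeddingNatCons_inl, embeddingNatCons_inr] at this
    · have := DFunLike.congr_fun h k
      simp [embeddingNatCons_inl, embeddingNatCons_inr] at this
    · have hk : k = k' := by
        by_contra hk
        have := DFunLike.congr_fun h k
        simp [embeddingNatCons_inr, hk] at this
      subst hk
      have : e = e' := by
        refine Function.Embedding.ext fun i => ?_
        have := DFunLike.congr_fun h i.1
        simpa [embeddingNatCons_inr, i.2] using this
      rw [this]
  · intro f
    by_cases hf : ∃ k, f k = 0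
    · obtain ⟨k, hk⟩ := hf
      have hne : ∀ i, i ≠ k → f i ≠ 0 := fun i hi h => hi (f.injective (h.trans hk.symm))
      refine ⟨.inr ⟨k, ⟨fun i => f i - 1, fun i j h => ?_⟩⟩, ?_⟩
      · have hi := hne i i.2
        have hj := hne j j.2
        simp only at h
        exact Subtype.ext (f.injective (by omega))
      · refine DFunLike.ext _ _ fun i => ?_
        by_cases hi : i = k
        · simp [embeddingNatCons_inr, hi, hk]
        · have := hne i hi
          rw [embeddingNatCons_inr, dif_neg hi]
          exact Nat.sub_add_cancel (Nat.pos_of_ne_zero this)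
    · push Not at hf
      refine ⟨.inl ⟨fun i => f i - 1, fun i j h => ?_⟩, ?_⟩
      · have hi := hf i
        have hj := hf j
        simp only at h
        exact f.injective (by omega)
      · refine DFunLike.ext _ _ fun i => ?_
        have := hf i
        rw [embeddingNatCons_inl]
        exact Nat.sub_add_cancel (Nat.pos_of_ne_zero this)

/-- Distinctness lets at most one block sit at index `0`; the sum is split according to which one,
if any. -/
lemma injSum_eq_succ {ι : Type*} [Fintype ι] [DecidableEq ι] (w : ℕ → ℝ≥0∞) (a : ι → ℝ) :
    injSum w a = injSum (fun j => w (j + 1)) a +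
      ∑ k, w 0 ^ a k * injSum (fun j => w (j + 1)) (fun i : {i // i ≠ k} => a i) := by
  rw [injSum, ← (Equiv.ofBijective _ (embeddingNatCons_bijective ι)).tsum_eq,
    Summable.tsum_sum ENNReal.summable ENNReal.summable, ENNReal.tsum_sigma']
  refine congrArg₂ _ rfl ?_
  rw [tsum_fintype]
  refine Finset.sum_congr rfl fun k _ => ?_
  rw [injSum, ← ENNReal.tsum_mul_left]
  refine tsum_congr fun e => ?_
  rw [Fintype.prod_eq_mul_prod_subtype_ne _ k]
  congr 1
  · simp [embeddingNatCons_inr]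
  · refine Finset.prod_congr rfl fun i _ => ?_
    simp [embeddingNatCons_inr, i.2]

/-! ### Stick breaking -/

lemma measurable_stickBreak : Measurable stickBreak := by
  rw [measurable_pi_iff]
  intro i
  unfold stickBreak
  exact (Finset.measurable_prod _ fun j _ => by fun_prop).mul (by fun_prop)

lemma stickBreak_zero (β : ℕ → ℝ) : stickBreak β 0 = β 0 := by simp [stickBreak]

/-- Self-similarity: what remains after the first break is itself broken by the shifted sequence. -/
lemma stickBreak_succ (β : ℕ → ℝ) (i : ℕ) :
    stickBreak β (i + 1) = (1 - β 0) * stickBreak (fun j => β (j + 1)) i := by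
  simp only [stickBreak, Finset.prod_range_succ']
  ring

lemma stickBreak_nonneg {β : ℕ → ℝ} (hβ : ∀ i, β i ∈ Set.Icc (0 : ℝ) 1) (i : ℕ) :
    0 ≤ stickBreak β i :=
  mul_nonneg (Finset.prod_nonneg fun j _ => by linarith [(hβ j).2]) (hβ i).1

lemma sum_range_stickBreak (β : ℕ → ℝ) (n : ℕ) :
    ∑ i ∈ Finset.range n, stickBreak β i = 1 - ∏ i ∈ Finset.range n, (1 - β i) := by
  induction n with
  | zero => simp
  | succ n ih => rw [Finset.sum_range_succ, ih, Finset.prod_range_succ, stickBreak]; ring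

lemma tsum_ofReal_stickBreak_le_one {β : ℕ → ℝ} (hβ : ∀ i, β i ∈ Set.Icc (0 : ℝ) 1) :
    ∑' i, ENNReal.ofReal (stickBreak β i) ≤ 1 := by
  refine ENNReal.tsum_le_of_sum_range_le fun n => ?_
  rw [← ENNReal.ofReal_sum_of_nonneg fun i _ => stickBreak_nonneg hβ i, sum_range_stickBreak]
  refine ENNReal.ofReal_le_one.2 ?_
  linarith [Finset.prod_nonneg fun i (_ : i ∈ Finset.range n) =>
    (by linarith [(hβ i).2] : 0 ≤ 1 - β i)]

/-- The joint law of the independent stick proportions. -/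
def pySticks (d α : ℝ) : Measure (ℕ → ℝ) :=
  Measure.infinitePi fun i : ℕ => betaMeasure (1 - d) (α + ((i : ℝ) + 1) * d)

lemma isProbabilityMeasure_sticks {d α : ℝ} (hd0 : 0 ≤ d) (hd1 : d < 1) (hα : -d < α) (i : ℕ) :
    IsProbabilityMeasure (betaMeasure (1 - d) (α + ((i : ℝ) + 1) * d)) :=
  isProbabilityMeasureBeta (by linarith) (by nlinarith [(i.cast_nonneg : (0 : ℝ) ≤ i)])

lemma isProbabilityMeasure_pySticks {d α : ℝ} (hd0 : 0 ≤ d) (hd1 : d < 1) (hα : -d < α) :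
    IsProbabilityMeasure (pySticks d α) := by
  have := isProbabilityMeasure_sticks hd0 hd1 hα
  unfold pySticks
  infer_instance

lemma pyMeasure_eq_map (d α : ℝ) : pyMeasure d α = (pySticks d α).map stickBreak := rfl

lemma isProbabilityMeasure_pyMeasure {d α : ℝ} (hd0 : 0 ≤ d) (hd1 : d < 1) (hα : -d < α) :
    IsProbabilityMeasure (pyMeasure d α) := by
  have := isProbabilityMeasure_pySticks hd0 hd1 hα
  rw [pyMeasure_eq_map]
  exact Measure.isProbabilityMeasure_map measurable_stickBreak.aemeasurable

lemma ae_pySticks_mem_Icc {d α : ℝ} (hd0 : 0 ≤ d) (hd1 : d < 1) (hα : -d < α) :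
    ∀ᵐ β ∂pySticks d α, ∀ i, β i ∈ Set.Icc (0 : ℝ) 1 := by
  have := isProbabilityMeasure_sticks hd0 hd1 hα
  rw [ae_all_iff]
  intro i
  have h : ∀ᵐ x ∂betaMeasure (1 - d) (α + ((i : ℝ) + 1) * d), x ∈ Set.Icc (0 : ℝ) 1 := by
    filter_upwards [ae_mem_Ioo_betaMeasure (1 - d) (α + ((i : ℝ) + 1) * d)] with x hx
      using Set.Ioo_subset_Icc_self hx
  rw [← (measurePreserving_eval_infinitePi
    (fun i : ℕ => betaMeasure (1 - d) (α + ((i : ℝ) + 1) * d)) i).map_eq] at h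
  exact ae_of_ae_map (measurable_pi_apply i).aemeasurable h

/-- Prepend a term to a sequence. -/
def consSeq {E : Type*} (q : E × (ℕ → E)) : ℕ → E := fun i => Nat.casesOn i q.1 q.2

lemma measurable_consSeq {E : Type*} [MeasurableSpace E] : Measurable (consSeq (E := E)) := by
  rw [measurable_pi_iff]
  rintro (_ | i)
  · exact measurable_fst
  · exact (measurable_pi_apply i).comp measurable_snd

/-- A cylinder over a finite index set is padded by full factors to one over an initial segment,
from which coordinate `0` splits off. -/
lemma infinitePi_eq_map_consSeq {E : Type*} [MeasurableSpace E] (μ : ℕ → Measure E)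
    [∀ i, IsProbabilityMeasure (μ i)] :
    Measure.infinitePi μ =
      ((μ 0).prod (Measure.infinitePi fun i => μ (i + 1))).map consSeq := by
  symm
  refine Measure.eq_infinitePi _ fun s t ht => ?_
  classical
  obtain ⟨n, hn⟩ : ∃ n, s ⊆ Finset.range (n + 1) :=
    ⟨s.sup id, fun i hi => Finset.mem_range.2 (Nat.lt_succ_of_le (Finset.le_sup (f := id) hi))⟩
  let t' : ℕ → Set E := fun i => if i ∈ s then t i else Set.univ
  have ht' : ∀ i, MeasurableSet (t' i) := fun i => by
    simp only [t']; split_ifs; exacts [ht i, MeasurableSet.univ]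
  have h1 : (s : Set ℕ).pi t = (Finset.range (n + 1) : Set ℕ).pi t' := by
    ext x
    simp only [Set.mem_pi, Finset.mem_coe]
    refine ⟨fun h i _ => ?_, fun h i hi => by simpa [t', hi] using h i (hn hi)⟩
    by_cases hi : i ∈ s
    · simpa [t', hi] using h i hi
    · simp [t', hi]
  have h2 : ∏ i ∈ s, μ i (t i) = ∏ i ∈ Finset.range (n + 1), μ i (t' i) := by
    rw [← Finset.prod_subset hn fun i _ hi => by simp [t', hi]]
    exact Finset.prod_congr rfl fun i hi => by simp [t', hi]
  have h3 : consSeq ⁻¹' ((Finset.range (n + 1) : Set ℕ).pi t') =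
      t' 0 ×ˢ (Finset.range n : Set ℕ).pi fun i => t' (i + 1) := by
    ext q
    simp only [Set.mem_preimage, Set.mem_pi, Set.mem_prod, Finset.mem_coe, Finset.mem_range]
    refine ⟨fun h => ⟨h 0 (by omega), fun i hi => h (i + 1) (by omega)⟩, ?_⟩
    rintro ⟨h0, h⟩ (_ | i) hi
    exacts [h0, h i (by omega)]
  rw [h1, h2, Measure.map_apply measurable_consSeq
    (MeasurableSet.pi (Finset.countable_toSet _) fun i _ => ht' i), h3, Measure.prod_prod,
    Measure.infinitePi_pi _ (fun i _ => ht' _), Finset.prod_range_succ', mul_comm]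

/-- The index shift in the parameters `α + (i + 1) d` is absorbed by replacing `α` with `α + d`. -/
lemma pySticks_eq_map_consSeq {d α : ℝ} (hd0 : 0 ≤ d) (hd1 : d < 1) (hα : -d < α) :
    pySticks d α = ((betaMeasure (1 - d) (α + d)).prod (pySticks d (α + d))).map consSeq := by
  have := isProbabilityMeasure_sticks hd0 hd1 hα
  rw [pySticks, infinitePi_eq_map_consSeq]
  congr 3
  · simp
  · funext i
    push_cast
    congr 1
    ring

/-! ### The partition function of the Pitman-Yor law -/

/-- The expectation of `injSum w a` for `w ∼ PY(d, α)`. -/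
def pyMoment (d α : ℝ) {ι : Type*} [Fintype ι] (a : ι → ℝ) : ℝ :=
  if Fintype.card ι = 0 then 1 else
    (∏ i ∈ Finset.range (Fintype.card ι - 1), (α + ((i : ℝ) + 1) * d)) *
      (Real.Gamma (α + 1) / Real.Gamma (α + ∑ i, a i)) *
      ∏ i, (Real.Gamma (a i - d) / Real.Gamma (1 - d))

/-- Using `Γ(α + 1) = α Γ(α)`, the extra factor `i = 0` makes the formula uniform in the number of
blocks, zero included. It needs `α > 0`, whereas the definition must also serve for `-d < α ≤ 0`;
the recursion uses it at `α + d` only. -/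
lemma pyMoment_of_pos {d α : ℝ} (hα : 0 < α) {ι : Type*} [Fintype ι] (a : ι → ℝ) :
    pyMoment d α a = (∏ i ∈ Finset.range (Fintype.card ι), (α + (i : ℝ) * d)) *
      (Real.Gamma α / Real.Gamma (α + ∑ i, a i)) *
      ∏ i, (Real.Gamma (a i - d) / Real.Gamma (1 - d)) := by
  unfold pyMoment
  split_ifs with h
  · have : IsEmpty ι := Fintype.card_eq_zero_iff.1 h
    simp [(Real.Gamma_pos_of_pos hα).ne']
  · obtain ⟨n, hn⟩ := Nat.exists_eq_succ_of_ne_zero h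
    rw [hn, Nat.succ_sub_one, Finset.prod_range_succ', Real.Gamma_add_one hα.ne']
    push_cast
    ring

section
variable {d α : ℝ} {ι : Type*} [Fintype ι] {a : ι → ℝ}

lemma one_le_sum_of_one_le [Nonempty ι] (ha : ∀ i, 1 ≤ a i) : 1 ≤ ∑ i, a i := by
  obtain ⟨k⟩ := ‹Nonempty ι›
  exact (ha k).trans
    (Finset.single_le_sum (fun i _ => zero_le_one.trans (ha i)) (Finset.mem_univ k))

lemma pyMoment_pos (hd0 : 0 ≤ d) (hd1 : d < 1) (hα : -d < α) (ha : ∀ i, 1 ≤ a i) :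
    0 < pyMoment d α a := by
  unfold pyMoment
  split_ifs with h
  · exact one_pos
  · have : Nonempty ι := Fintype.card_pos_iff.1 (Nat.pos_of_ne_zero h)
    have hA := one_le_sum_of_one_le ha
    refine mul_pos (mul_pos (Finset.prod_pos fun i _ => ?_) (div_pos ?_ ?_))
      (Finset.prod_pos fun i _ => div_pos ?_ ?_)
    · nlinarith [(i.cast_nonneg : (0 : ℝ) ≤ i)]
    all_goals refine Real.Gamma_pos_of_pos ?_
    · linarith
    · linarith
    · linarith [ha i]
    · linarith

/-- With `A = ∑ a i` and `K` blocks, the terms on the right are `pyMoment d α a` times `(α + K d) /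
(α + A)` and `(a k - d) / (α + A)`, and these fractions sum to one. -/
lemma pyMoment_eq_succ [DecidableEq ι] [Nonempty ι] (hd1 : d < 1) (hα : -d < α)
    (ha : ∀ i, 1 ≤ a i) :
    pyMoment d α a =
      beta (1 - d) (α + d + ∑ i, a i) / beta (1 - d) (α + d) * pyMoment d (α + d) a +
      ∑ k, beta (1 - d + a k) (α + d + ∑ i : {i // i ≠ k}, a i) / beta (1 - d) (α + d) *
        pyMoment d (α + d) (fun i : {i // i ≠ k} => a i) := by
  have hA := one_le_sum_of_one_le ha
  set A := ∑ i, a i with hAdef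
  have hαd : 0 < α + d := by linarith
  obtain ⟨n, hn⟩ := Nat.exists_eq_succ_of_ne_zero (Fintype.card_ne_zero (α := ι))
  have hΓ1 := (Real.Gamma_pos_of_pos (by linarith : 0 < 1 - d)).ne'
  have hΓ2 := (Real.Gamma_pos_of_pos hαd).ne'
  have hΓ3 := (Real.Gamma_pos_of_pos (by linarith : 0 < α + 1)).ne'
  have hαA : 0 < α + A := by linarith
  have hΓ4 := (Real.Gamma_pos_of_pos hαA).ne'
  have hΓ5 := (Real.Gamma_pos_of_pos (by linarith : 0 < α + d + A)).ne'
  set Q := ∏ i, (Real.Gamma (a i - d) / Real.Gamma (1 - d)) with hQ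
  set P := ∏ i ∈ Finset.range n, (α + ((i : ℝ) + 1) * d) with hP
  have hP1 : ∏ i ∈ Finset.range (n + 1), (α + d + (i : ℝ) * d) = P * (α + (n + 1) * d) := by
    rw [Finset.prod_range_succ, hP]
    congr 1
    · exact Finset.prod_congr rfl fun i _ => by ring
    · ring
  have hP2 : ∏ i ∈ Finset.range n, (α + d + (i : ℝ) * d) = P :=
    Finset.prod_congr rfl fun i _ => by ring
  have hL : pyMoment d α a = P * (Real.Gamma (α + 1) / Real.Gamma (α + A)) * Q := by
    rw [pyMoment, if_neg Fintype.card_ne_zero, hn, Nat.succ_sub_one]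
  have hT1 : beta (1 - d) (α + d + A) / beta (1 - d) (α + d) * pyMoment d (α + d) a =
      P * (Real.Gamma (α + 1) / Real.Gamma (α + A + 1)) * Q * (α + (n + 1) * d) := by
    rw [pyMoment_of_pos hαd, hn, Nat.succ_eq_add_one, hP1, ← hAdef, ← hQ, beta, beta,
      show 1 - d + (α + d + A) = α + A + 1 by ring, show 1 - d + (α + d) = α + 1 by ring,
      Real.Gamma_add_one hαA.ne']
    field_simp
  have hT2 : ∀ k, beta (1 - d + a k) (α + d + ∑ i : {i // i ≠ k}, a i) / beta (1 - d) (α + d) *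
        pyMoment d (α + d) (fun i : {i // i ≠ k} => a i) =
      P * (Real.Gamma (α + 1) / Real.Gamma (α + A + 1)) * Q * (a k - d) := by
    intro k
    have hcard : Fintype.card {i // i ≠ k} = n := by
      rw [Fintype.card_subtype_compl, Fintype.card_subtype_eq, hn, Nat.succ_sub_one]
    have hAk : A = a k + ∑ i : {i // i ≠ k}, a i := Fintype.sum_eq_add_sum_subtype_ne a k
    have hQk : Q = Real.Gamma (a k - d) / Real.Gamma (1 - d) *
        ∏ i : {i // i ≠ k}, (Real.Gamma (a i - d) / Real.Gamma (1 - d)) :=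
      Fintype.prod_eq_mul_prod_subtype_ne _ k
    have hA' : 0 ≤ ∑ i : {i // i ≠ k}, a i := Finset.sum_nonneg fun i _ => by linarith [ha i]
    have hΓ6 := (Real.Gamma_pos_of_pos
      (by linarith : 0 < α + d + ∑ i : {i // i ≠ k}, a i)).ne'
    have hak : 0 < a k - d := by linarith [ha k]
    rw [pyMoment_of_pos hαd, hcard, hP2, hQk, beta, beta,
      show 1 - d + a k + (α + d + ∑ i : {i // i ≠ k}, a i) = α + A + 1 by rw [hAk]; ring,
      show 1 - d + (α + d) = α + 1 by ring, show 1 - d + a k = a k - d + 1 by ring,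
      Real.Gamma_add_one hαA.ne', Real.Gamma_add_one hak.ne']
    field_simp
  rw [hT1, Finset.sum_congr rfl fun k _ => hT2 k, ← Finset.mul_sum, Finset.sum_sub_distrib,
    ← hAdef, Finset.sum_const, Finset.card_univ, hn, hL, Real.Gamma_add_one hαA.ne', nsmul_eq_mul]
  push_cast
  field_simp
  ring

/-- For `d = 0` the sequence is constant. For `d > 0` the parameter `γ = α + n d` tends to infinity,
and `Γ(γ) ∏ (γ + i d) ≤ Γ(γ + K) ≤ Γ(γ + ∑ a i)` leaves only the factors that do not depend on `γ`.
-/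
lemma exists_eventually_pyMoment_le (hd0 : 0 ≤ d) (hd1 : d < 1)
    (ha : ∀ i, 1 ≤ a i) : ∃ C, ∀ᶠ n : ℕ in atTop, pyMoment d (α + n * d) a ≤ C := by
  rcases eq_or_lt_of_le hd0 with h | h
  · exact ⟨pyMoment d α a, Eventually.of_forall fun n => by rw [← h]; simp⟩
  refine ⟨∏ i, (Real.Gamma (a i - d) / Real.Gamma (1 - d)), ?_⟩
  have hQ : 0 ≤ ∏ i, (Real.Gamma (a i - d) / Real.Gamma (1 - d)) :=
    Finset.prod_nonneg fun i _ => div_nonneg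
      (Real.Gamma_pos_of_pos (by linarith [ha i])).le (Real.Gamma_pos_of_pos (by linarith)).le
  have hlim : Tendsto (fun n : ℕ => α + n * d) atTop atTop :=
    tendsto_atTop_add_const_left _ _ (tendsto_natCast_atTop_atTop.atTop_mul_const h)
  -- The threshold `2` is where the Gamma function is known to be increasing.
  filter_upwards [hlim.eventually_ge_atTop 2] with n hn
  set γ := α + n * d
  have hγ : 0 < γ := by linarith
  rw [pyMoment_of_pos hγ]
  refine mul_le_of_le_one_left hQ ?_
  have hprod : ∀ K : ℕ, (∏ i ∈ Finset.range K, (γ + (i : ℝ) * d)) * Real.Gamma γ ≤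
      Real.Gamma (γ + K) := by
    intro K
    induction K with
    | zero => simp
    | succ K ih =>
      have hK : (0 : ℝ) ≤ K := K.cast_nonneg
      rw [Finset.prod_range_succ, Nat.cast_succ, ← add_assoc, Real.Gamma_add_one (by positivity)]
      have : γ + K * d ≤ γ + K := by nlinarith
      calc _ = (γ + K * d) * ((∏ i ∈ Finset.range K, (γ + (i : ℝ) * d)) * Real.Gamma γ) := by ring
        _ ≤ _ := mul_le_mul this ih (mul_nonneg (Finset.prod_nonneg fun i _ => by positivity)
              (Real.Gamma_pos_of_pos hγ).le) (by positivity)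
  have hA : (Fintype.card ι : ℝ) ≤ ∑ i, a i := by
    simpa using Finset.sum_le_sum fun i (_ : i ∈ Finset.univ) => ha i
  have hK : (0 : ℝ) ≤ Fintype.card ι := Nat.cast_nonneg _
  have hmono := Real.Gamma_strictMonoOn_Ici.monotoneOn (a := γ + Fintype.card ι)
    (b := γ + ∑ i, a i) (Set.mem_Ici.2 (by linarith)) (Set.mem_Ici.2 (by linarith)) (by linarith)
  rw [← mul_div_assoc, div_le_one (Real.Gamma_pos_of_pos (by linarith))]
  exact (hprod _).trans hmono

end

/-- A sequence with `D n = c n * D (n + 1)` vanishes if it is bounded and `∏ c` diverges to `0`. -/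
lemma eq_zero_of_eq_mul_succ {D c : ℕ → ℝ} {C ε : ℝ} (hε : 0 < ε) (hD : ∀ n, D n = c n * D (n + 1))
    (hC : ∀ᶠ n in atTop, |D n| ≤ C) (hc0 : ∀ n, 0 ≤ c n)
    (hc : ∀ n : ℕ, c n ≤ 1 - ε * (1 / ((n : ℝ) + 1))) : D 0 = 0 := by
  have h1 : ∀ n, D 0 = (∏ i ∈ Finset.range n, c i) * D n := by
    intro n
    induction n with
    | zero => simp
    | succ n ih => rw [ih, hD n, Finset.prod_range_succ, mul_assoc]
  have h2 : ∀ n, ∏ i ∈ Finset.range n, c i ≤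
      Real.exp (-(ε * ∑ i ∈ Finset.range n, 1 / ((i : ℝ) + 1))) := by
    intro n
    rw [Finset.mul_sum, ← Finset.sum_neg_distrib, Real.exp_sum]
    refine Finset.prod_le_prod (fun i _ => hc0 i) fun i _ => (hc i).trans ?_
    linarith [Real.add_one_le_exp (-(ε * (1 / ((i : ℝ) + 1))))]
  have h3 : Tendsto (fun n : ℕ => Real.exp (-(ε * ∑ i ∈ Finset.range n, 1 / ((i : ℝ) + 1))) * C)
      atTop (𝓝 (0 * C)) :=
    (Real.tendsto_exp_neg_atTop_nhds_zero.comp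
      (Real.tendsto_sum_range_one_div_nat_succ_atTop.const_mul_atTop hε)).mul_const C
  rw [zero_mul] at h3
  have h4 : |D 0| ≤ 0 := by
    refine ge_of_tendsto h3 ?_
    filter_upwards [hC] with n hn
    rw [h1 n, abs_mul, abs_of_nonneg (Finset.prod_nonneg fun i _ => hc0 i)]
    exact mul_le_mul (h2 n) hn (abs_nonneg _) (Real.exp_pos _).le
  exact abs_nonpos_iff.1 h4

lemma injSum_stickBreak_consSeq {ι : Type*} [Fintype ι] [DecidableEq ι] {a : ι → ℝ}
    (ha : ∀ i, 0 ≤ a i) {b : ℝ} (hb : b ≤ 1) (β : ℕ → ℝ) :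
    injSum (fun j => ENNReal.ofReal (stickBreak (consSeq (b, β)) j)) a =
      ENNReal.ofReal (1 - b) ^ (∑ i, a i) * injSum (fun j => ENNReal.ofReal (stickBreak β j)) a +
      ∑ k, ENNReal.ofReal b ^ a k * ENNReal.ofReal (1 - b) ^ (∑ i : {i // i ≠ k}, a i) *
        injSum (fun j => ENNReal.ofReal (stickBreak β j)) fun i : {i // i ≠ k} => a i := by
  have h0 : stickBreak (consSeq (b, β)) 0 = b := stickBreak_zero _
  have h1 : ∀ j, ENNReal.ofReal (stickBreak (consSeq (b, β)) (j + 1)) =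
      ENNReal.ofReal (1 - b) * ENNReal.ofReal (stickBreak β j) := fun j => by
    rw [stickBreak_succ, ← ENNReal.ofReal_mul (by linarith)]
    rfl
  rw [injSum_eq_succ]
  simp_rw [h1, h0]
  rw [injSum_mul _ _ ha]
  congr 1
  refine Finset.sum_congr rfl fun k _ => ?_
  rw [injSum_mul (a := fun i : {i // i ≠ k} => a i) _ _ fun i => ha i, mul_assoc]

lemma measurable_injSum_stickBreak {ι : Type*} [Fintype ι] (a : ι → ℝ) :
    Measurable fun β : ℕ → ℝ => injSum (fun j => ENNReal.ofReal (stickBreak β j)) a :=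
  measurable_injSum
    (fun j => ((measurable_pi_apply j).comp measurable_stickBreak).ennreal_ofReal) a

/-- Integration over the first stick: its powers are independent of the remaining sticks and
contribute Beta moments. `pyMoment_eq_succ` is the same recursion for the closed form. -/
lemma lintegral_injSum_pySticks_succ {d : ℝ} (hd0 : 0 ≤ d) (hd1 : d < 1) {ι : Type*} [Fintype ι]
    [DecidableEq ι] {a : ι → ℝ} (ha : ∀ i, 0 ≤ a i) {α : ℝ} (hα : -d < α) :
    ∫⁻ β, injSum (fun j => ENNReal.ofReal (stickBreak β j)) a ∂pySticks d α =
      ENNReal.ofReal (beta (1 - d) (α + d + ∑ i, a i) / beta (1 - d) (α + d)) *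
        ∫⁻ β, injSum (fun j => ENNReal.ofReal (stickBreak β j)) a ∂pySticks d (α + d) +
      ∑ k, ENNReal.ofReal
          (beta (1 - d + a k) (α + d + ∑ i : {i // i ≠ k}, a i) / beta (1 - d) (α + d)) *
        ∫⁻ β, injSum (fun j => ENNReal.ofReal (stickBreak β j)) (fun i : {i // i ≠ k} => a i)
          ∂pySticks d (α + d) := by
  have h1d : 0 < 1 - d := by linarith
  have hαd : 0 < α + d := by linarith
  have := isProbabilityMeasure_pySticks hd0 hd1 (by linarith : -d < α + d)
  have := isProbabilityMeasureBeta h1d hαd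
  have hA : 0 ≤ ∑ i, a i := Finset.sum_nonneg fun i _ => ha i
  have hA' : ∀ k, 0 ≤ ∑ i : {i // i ≠ k}, a i := fun k => Finset.sum_nonneg fun i _ => ha i.1
  rw [pySticks_eq_map_consSeq hd0 hd1 hα,
    lintegral_map (measurable_injSum_stickBreak a) measurable_consSeq,
    lintegral_prod (fun q : ℝ × (ℕ → ℝ) =>
      injSum (fun j => ENNReal.ofReal (stickBreak (consSeq q) j)) a)
      ((measurable_injSum_stickBreak a).comp measurable_consSeq).aemeasurable]
  have hstep : ∀ᵐ b ∂betaMeasure (1 - d) (α + d),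
      ∫⁻ β, injSum (fun j => ENNReal.ofReal (stickBreak (consSeq (b, β)) j)) a
        ∂pySticks d (α + d) =
      ENNReal.ofReal b ^ (0 : ℝ) * ENNReal.ofReal (1 - b) ^ (∑ i, a i) *
        ∫⁻ β, injSum (fun j => ENNReal.ofReal (stickBreak β j)) a ∂pySticks d (α + d) +
      ∑ k, ENNReal.ofReal b ^ a k * ENNReal.ofReal (1 - b) ^ (∑ i : {i // i ≠ k}, a i) *
        ∫⁻ β, injSum (fun j => ENNReal.ofReal (stickBreak β j)) (fun i : {i // i ≠ k} => a i)
          ∂pySticks d (α + d) := by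
    filter_upwards [ae_mem_Ioo_betaMeasure (1 - d) (α + d)] with b hb
    simp_rw [injSum_stickBreak_consSeq ha hb.2.le]
    rw [lintegral_add_left ((measurable_injSum_stickBreak a).const_mul _),
      lintegral_const_mul _ (measurable_injSum_stickBreak a), lintegral_finsetSum _ fun k _ =>
        (measurable_injSum_stickBreak _).const_mul _, ENNReal.rpow_zero, one_mul]
    congr 1
    exact Finset.sum_congr rfl fun k _ => lintegral_const_mul _ (measurable_injSum_stickBreak _)
  rw [lintegral_congr_ae hstep, lintegral_add_left (by fun_prop),
    lintegral_mul_const _ (by fun_prop), lintegral_finsetSum _ fun k _ => by fun_prop,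
    lintegral_betaMeasure_rpow h1d hαd le_rfl hA, add_zero]
  congr 1
  refine Finset.sum_congr rfl fun k _ => ?_
  rw [lintegral_mul_const _ (by fun_prop), lintegral_betaMeasure_rpow h1d hαd (ha k) (hA' k)]

/-- For `b ∼ Beta(p, q)` the left side is the mean of `(1 - b) ^ A`, at most the mean of `1 - b`
because `A ≥ 1`. -/
lemma beta_add_div_beta_le {p q A : ℝ} (hp : 0 < p) (hq : 0 < q) (hA : 1 ≤ A) :
    beta p (q + A) / beta p q ≤ 1 - p / (p + q) := by
  have e1 := lintegral_betaMeasure_rpow hp hq le_rfl (by linarith : 0 ≤ A)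
  have e2 := lintegral_betaMeasure_rpow hp hq le_rfl zero_le_one
  rw [add_zero] at e1 e2
  have hle : ENNReal.ofReal (beta p (q + A) / beta p q) ≤
      ENNReal.ofReal (beta p (q + 1) / beta p q) := by
    rw [← e1, ← e2]
    refine lintegral_mono_ae ?_
    filter_upwards [ae_mem_Ioo_betaMeasure p q] with b hb
    refine mul_le_mul_right (ENNReal.rpow_le_rpow_of_exponent_ge ?_ hA) _
    exact ENNReal.ofReal_le_one.2 (by linarith [hb.1])
  rw [ENNReal.ofReal_le_ofReal_iff
    (div_nonneg (beta_pos hp (by linarith)).le (beta_pos hp hq).le)] at hle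
  refine hle.trans (le_of_eq ?_)
  have hΓ1 := (Real.Gamma_pos_of_pos hp).ne'
  have hΓ2 := (Real.Gamma_pos_of_pos hq).ne'
  have hpq : p + q ≠ 0 := by linarith
  have hΓ3 := (Real.Gamma_pos_of_pos (by linarith : 0 < p + q)).ne'
  rw [beta, beta, ← add_assoc, Real.Gamma_add_one hpq, Real.Gamma_add_one hq.ne']
  field_simp
  ring

/-- When the formula is known with any one block removed, the inhomogeneous terms of the two
recursions cancel, and the error satisfies a linear recursion. -/
lemma toReal_lintegral_injSum_sub {d : ℝ} (hd0 : 0 ≤ d) (hd1 : d < 1) {ι : Type*} [Fintype ι]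
    [DecidableEq ι] [Nonempty ι] {a : ι → ℝ} (ha : ∀ i, 1 ≤ a i) {α : ℝ} (hα : -d < α)
    (hfin : ∫⁻ β, injSum (fun j => ENNReal.ofReal (stickBreak β j)) a ∂pySticks d (α + d) ≠ ∞)
    (hsub : ∀ k : ι, ∫⁻ β, injSum (fun j => ENNReal.ofReal (stickBreak β j))
        (fun i : {i // i ≠ k} => a i) ∂pySticks d (α + d) =
      ENNReal.ofReal (pyMoment d (α + d) (fun i : {i // i ≠ k} => a i))) :
    (∫⁻ β, injSum (fun j => ENNReal.ofReal (stickBreak β j)) a ∂pySticks d α).toReal -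
        pyMoment d α a =
      beta (1 - d) (α + d + ∑ i, a i) / beta (1 - d) (α + d) *
        ((∫⁻ β, injSum (fun j => ENNReal.ofReal (stickBreak β j)) a ∂pySticks d (α + d)).toReal -
          pyMoment d (α + d) a) := by
  have hA := one_le_sum_of_one_le ha
  have h1d : 0 < 1 - d := by linarith
  have hαd : 0 < α + d := by linarith
  have hc : 0 ≤ beta (1 - d) (α + d + ∑ i, a i) / beta (1 - d) (α + d) :=
    div_nonneg (beta_pos h1d (by linarith)).le (beta_pos h1d hαd).le
  have hb : ∀ k,
      0 ≤ beta (1 - d + a k) (α + d + ∑ i : {i // i ≠ k}, a i) / beta (1 - d) (α + d) := by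
    intro k
    have h1 : 0 ≤ ∑ i : {i // i ≠ k}, a i :=
      Finset.sum_nonneg fun i _ => zero_le_one.trans (ha i.1)
    exact div_nonneg (beta_pos (by linarith [ha k]) (by linarith)).le (beta_pos h1d hαd).le
  have hα' : -d < α + d := by linarith
  have hm : ∀ k : ι, 0 ≤ pyMoment d (α + d) (fun i : {i // i ≠ k} => a i) := by
    intro k
    exact (pyMoment_pos hd0 hd1 hα' fun i : {i // i ≠ k} => ha i.1).le
  have hnn : ∀ k ∈ (Finset.univ : Finset ι), 0 ≤
      beta (1 - d + a k) (α + d + ∑ i : {i // i ≠ k}, a i) / beta (1 - d) (α + d) *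
        pyMoment d (α + d) (fun i : {i // i ≠ k} => a i) := by
    intro k _
    exact mul_nonneg (hb k) (hm k)
  have hr : ∑ k, ENNReal.ofReal
          (beta (1 - d + a k) (α + d + ∑ i : {i // i ≠ k}, a i) / beta (1 - d) (α + d)) *
        ∫⁻ β, injSum (fun j => ENNReal.ofReal (stickBreak β j)) (fun i : {i // i ≠ k} => a i)
          ∂pySticks d (α + d) =
      ENNReal.ofReal (∑ k, beta (1 - d + a k) (α + d + ∑ i : {i // i ≠ k}, a i) /
        beta (1 - d) (α + d) * pyMoment d (α + d) (fun i : {i // i ≠ k} => a i)) := by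
    rw [ENNReal.ofReal_sum_of_nonneg hnn]
    refine Finset.sum_congr rfl fun k _ => ?_
    rw [hsub k, ENNReal.ofReal_mul (hb k)]
  rw [lintegral_injSum_pySticks_succ hd0 hd1 (fun i => zero_le_one.trans (ha i)) hα, hr,
    ENNReal.toReal_add (ENNReal.mul_ne_top ENNReal.ofReal_ne_top hfin) ENNReal.ofReal_ne_top,
    ENNReal.toReal_mul, ENNReal.toReal_ofReal hc, ENNReal.toReal_ofReal (Finset.sum_nonneg hnn),
    pyMoment_eq_succ hd1 hα ha]
  generalize ∑ k, beta (1 - d + a k) (α + d + ∑ i : {i // i ≠ k}, a i) /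
        beta (1 - d) (α + d) * pyMoment d (α + d) (fun i : {i // i ≠ k} => a i) = r
  ring

/-- The expectation of a power sum over distinct indices, for Pitman-Yor weights. -/
theorem lintegral_injSum_pySticks {d : ℝ} (hd0 : 0 ≤ d) (hd1 : d < 1) {ι : Type*} [Fintype ι]
    {a : ι → ℝ} (ha : ∀ i, 1 ≤ a i) {α : ℝ} (hα : -d < α) :
    ∫⁻ β, injSum (fun j => ENNReal.ofReal (stickBreak β j)) a ∂pySticks d α =
      ENNReal.ofReal (pyMoment d α a) := by
  classical
  -- The parameter `α` varies in the induction, since the formula for fewer blocks is used at `α +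
  -- d`.
  induction hn : Fintype.card ι generalizing ι α with
  | zero =>
    have := isProbabilityMeasure_pySticks hd0 hd1 hα
    have : IsEmpty ι := Fintype.card_eq_zero_iff.1 hn
    simp [injSum, pyMoment]
  | succ n ih =>
    have hne : Nonempty ι := Fintype.card_pos_iff.1 (by omega)
    have hA := one_le_sum_of_one_le ha
    let F : ℝ → ℝ≥0∞ := fun γ =>
      ∫⁻ β, injSum (fun j => ENNReal.ofReal (stickBreak β j)) a ∂pySticks d γ
    have hF1 : ∀ γ, -d < γ → F γ ≤ 1 := fun γ hγ => by
      have := isProbabilityMeasure_pySticks hd0 hd1 hγ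
      calc F γ ≤ ∫⁻ _, 1 ∂pySticks d γ := by
            refine lintegral_mono_ae ?_
            filter_upwards [ae_pySticks_mem_Icc hd0 hd1 hγ] with β hβ
            exact injSum_le_one (tsum_ofReal_stickBreak_le_one hβ) ha
        _ = 1 := by simp
    have hne_top : ∀ γ, -d < γ → F γ ≠ ∞ := fun γ hγ =>
      ne_top_of_le_ne_top ENNReal.one_ne_top (hF1 γ hγ)
    let c : ℝ → ℝ := fun γ => beta (1 - d) (γ + d + ∑ i, a i) / beta (1 - d) (γ + d)
    have hc0 : ∀ γ, -d < γ → 0 ≤ c γ := fun γ hγ =>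
      div_nonneg (beta_pos (by linarith) (by linarith)).le (beta_pos (by linarith) (by linarith)).le
    have hDrec : ∀ γ, -d < γ → (F γ).toReal - pyMoment d γ a =
        c γ * ((F (γ + d)).toReal - pyMoment d (γ + d) a) := fun γ hγ =>
      have hγd : -d < γ + d := by linarith
      toReal_lintegral_injSum_sub hd0 hd1 ha hγ (hne_top _ hγd) fun k =>
        ih (ι := {i // i ≠ k}) (fun i => ha i.1) hγd (by
          rw [Fintype.card_subtype_compl, Fintype.card_subtype_eq, hn, Nat.add_sub_cancel])
    have hγn : ∀ n : ℕ, -d < α + n * d := fun n => by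
      nlinarith [(n.cast_nonneg : (0 : ℝ) ≤ n)]
    obtain ⟨C, hC⟩ := exists_eventually_pyMoment_le (α := α) hd0 hd1 ha
    -- The contraction factor is at most `1 - (1 - d) / (1 + α + n d)`, and `1 + α + n d ≤ (α + 2)
    -- (n + 1)` explains `ε`. The constant `1 + C` adds the bounds for the expectation and for
    -- `pyMoment`.
    have hD := eq_zero_of_eq_mul_succ (D := fun n : ℕ => (F (α + n * d)).toReal -
      pyMoment d (α + n * d) a) (c := fun n : ℕ => c (α + n * d)) (C := 1 + C)
      (ε := (1 - d) / (α + 2)) (div_pos (by linarith) (by linarith))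
      (fun n => by
        have := hDrec _ (hγn n)
        rw [add_assoc, ← add_one_mul] at this
        push_cast
        exact this)
      (by
        filter_upwards [hC] with n hn
        have h1 : (F (α + n * d)).toReal ≤ 1 :=
          ENNReal.toReal_mono ENNReal.one_ne_top (hF1 _ (hγn n))
        have h2 : 0 ≤ (F (α + n * d)).toReal := ENNReal.toReal_nonneg
        have h3 := pyMoment_pos hd0 hd1 (hγn n) ha
        rw [abs_le]
        constructor <;> linarith)
      (fun n => hc0 _ (hγn n))
      (fun n => by
        have hγ := hγn n
        refine (beta_add_div_beta_le (by linarith) (by linarith) hA).trans ?_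
        have hn0 : (0 : ℝ) ≤ n := n.cast_nonneg
        have : (1 - d) / (α + 2) * (1 / ((n : ℝ) + 1)) ≤ (1 - d) / (1 - d + (α + n * d + d)) := by
          rw [div_mul_div_comm, mul_one]
          refine div_le_div_of_nonneg_left (by linarith) (by linarith) ?_
          nlinarith
        linarith)
    simp only [Nat.cast_zero, zero_mul, add_zero] at hD
    change F α = _
    rw [← ENNReal.ofReal_toReal (hne_top α hα), sub_eq_zero.1 hD]

/-! ### Logarithmic moments of Pitman-Yor weights -/

lemma hasDerivAt_Gamma_psi0 {x : ℝ} (hx : 0 < x) :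
    HasDerivAt Real.Gamma (Real.Gamma x * psi0 x) x := by
  have hne : ∀ m : ℕ, x ≠ -m := fun m h => by
    have : (0 : ℝ) ≤ m := m.cast_nonneg
    linarith
  have h : Real.Gamma x * psi0 x = deriv Real.Gamma x := by
    have := (Real.Gamma_pos_of_pos hx).ne'
    unfold psi0
    rw [logDeriv_apply]
    field_simp
  rw [h]
  exact (Real.differentiableAt_Gamma hne).hasDerivAt

/-- The common shape of the power moments, for Pitman-Yor weights and Dirichlet coordinates alike,
as functions of the additional exponent `s`. -/
lemma hasDerivAt_Gamma_ratio (c : ℝ) {x y : ℝ} (hx : 0 < x) (hy : 0 < y) :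
    HasDerivAt (fun s => c * (Real.Gamma x / Real.Gamma (x + s)) *
      (Real.Gamma (y + s) / Real.Gamma y)) (c * (psi0 y - psi0 x)) 0 := by
  have hΓx := (Real.Gamma_pos_of_pos hx).ne'
  have hΓy := (Real.Gamma_pos_of_pos hy).ne'
  have hs : ∀ z : ℝ, 0 < z →
      HasDerivAt (fun s => Real.Gamma (z + s)) (Real.Gamma z * psi0 z) 0 := fun z hz => by
    have h := hasDerivAt_Gamma_psi0 hz
    rw [← add_zero z] at h
    simpa using h.comp_const_add z 0
  have h1 := ((hasDerivAt_const (0 : ℝ) (Real.Gamma x)).div (hs x hx)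
    (by simpa using hΓx)).const_mul c
  refine (h1.mul ((hs y hy).div_const (Real.Gamma y))).congr_deriv ?_
  simp only [add_zero, Pi.div_apply]
  field_simp
  ring

section
variable {d α : ℝ} {ι : Type*} [Fintype ι] {a : ι → ℝ}

lemma sum_update_add [DecidableEq ι] (a : ι → ℝ) (k : ι) (s : ℝ) :
    ∑ i, Function.update a k (a k + s) i = ∑ i, a i + s := by
  rw [Finset.sum_update_of_mem (Finset.mem_univ k), ← Finset.add_sum_erase _ a (Finset.mem_univ k),
    Finset.sdiff_singleton_eq_erase]
  ring

lemma pyMoment_update [DecidableEq ι] [Nonempty ι] (hd1 : d < 1) (hα : -d < α)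
    (ha : ∀ i, 1 ≤ a i) (k : ι) (s : ℝ) :
    pyMoment d α (Function.update a k (a k + s)) =
      pyMoment d α a * (Real.Gamma (α + ∑ i, a i) / Real.Gamma (α + ∑ i, a i + s)) *
        (Real.Gamma (a k - d + s) / Real.Gamma (a k - d)) := by
  have hA := one_le_sum_of_one_le ha
  have hΓ1 := (Real.Gamma_pos_of_pos (by linarith [ha k] : 0 < a k - d)).ne'
  have hΓ2 := (Real.Gamma_pos_of_pos (by linarith : 0 < α + ∑ i, a i)).ne'
  rw [pyMoment, pyMoment, if_neg Fintype.card_ne_zero, if_neg Fintype.card_ne_zero, sum_update_add,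
    ← Finset.mul_prod_erase _ _ (Finset.mem_univ k),
    ← Finset.mul_prod_erase _ (fun i => Real.Gamma (a i - d) / Real.Gamma (1 - d))
      (Finset.mem_univ k), Function.update_self,
    Finset.prod_congr rfl fun i (hi : i ∈ Finset.univ.erase k) => by
      rw [Function.update_of_ne (Finset.ne_of_mem_erase hi)],
    show a k + s - d = a k - d + s by ring, ← add_assoc α]
  generalize ∏ i ∈ Finset.range (Fintype.card ι - 1), (α + ((i : ℝ) + 1) * d) = P
  field_simp

/-- The factor is the predictive probability that the next observation repeats symbol `k`; in
`pyMoment_option_one` it is that of a new symbol. -/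
lemma pyMoment_update_add_one [DecidableEq ι] [Nonempty ι] (hd1 : d < 1)
    (hα : -d < α) (ha : ∀ i, 1 ≤ a i) (k : ι) :
    pyMoment d α (Function.update a k (a k + 1)) =
      pyMoment d α a * ((a k - d) / (α + ∑ i, a i)) := by
  have hA := one_le_sum_of_one_le ha
  have h1 : 0 < a k - d := by linarith [ha k]
  have h2 : 0 < α + ∑ i, a i := by linarith
  have hΓ1 := (Real.Gamma_pos_of_pos h1).ne'
  have hΓ2 := (Real.Gamma_pos_of_pos h2).ne'
  rw [pyMoment_update hd1 hα ha k 1, Real.Gamma_add_one h1.ne',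
    Real.Gamma_add_one h2.ne']
  field_simp

lemma pyMoment_option_one [Nonempty ι] (hd1 : d < 1) (hα : -d < α)
    (ha : ∀ i, 1 ≤ a i) :
    pyMoment d α (fun o : Option ι => o.elim 1 a) =
      pyMoment d α a * ((α + Fintype.card ι * d) / (α + ∑ i, a i)) := by
  have hA := one_le_sum_of_one_le ha
  obtain ⟨n, hn⟩ := Nat.exists_eq_succ_of_ne_zero (Fintype.card_ne_zero (α := ι))
  have h2 : 0 < α + ∑ i, a i := by linarith
  have hΓ1 := (Real.Gamma_pos_of_pos (by linarith : 0 < 1 - d)).ne'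
  have hΓ2 := (Real.Gamma_pos_of_pos h2).ne'
  rw [pyMoment, pyMoment, if_neg Fintype.card_ne_zero, if_neg Fintype.card_ne_zero,
    Fintype.card_option, hn, Fintype.sum_option, Fintype.prod_option, Nat.add_sub_cancel,
    Nat.succ_sub_one, Finset.prod_range_succ]
  simp only [Option.elim_none, Option.elim_some]
  rw [show α + (1 + ∑ i, a i) = α + ∑ i, a i + 1 by ring, Real.Gamma_add_one h2.ne',
    div_self hΓ1]
  generalize ∏ i ∈ Finset.range n, (α + ((i : ℝ) + 1) * d) = P
  push_cast
  field_simp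

end

lemma ofReal_rpow_add_prod {ι : Type*} [Fintype ι] [DecidableEq ι] (w : ι → ℝ≥0∞) {a : ι → ℝ}
    (ha : ∀ i, 0 ≤ a i) (k : ι) {t : ℝ} (ht : 0 ≤ t) :
    (∏ i, w i ^ a i) * w k ^ t = ∏ i, w i ^ Function.update a k (a k + t) i := by
  rw [← Finset.mul_prod_erase _ _ (Finset.mem_univ k),
    ← Finset.mul_prod_erase _ (fun i => w i ^ Function.update a k (a k + t) i) (Finset.mem_univ k),
    Finset.prod_congr rfl fun i (hi : i ∈ Finset.univ.erase k) => by
      rw [← Function.update_of_ne (Finset.ne_of_mem_erase hi) (a k + t) a],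
    Function.update_self, ENNReal.rpow_add_of_nonneg _ _ (ha k) ht]
  ring

lemma measurable_stickBreak_apply (i : ℕ) : Measurable fun β : ℕ → ℝ => stickBreak β i :=
  (measurable_pi_apply i).comp measurable_stickBreak

lemma ae_stickBreak_mem_Icc {d α : ℝ} (hd0 : 0 ≤ d) (hd1 : d < 1) (hα : -d < α) :
    ∀ᵐ β ∂pySticks d α, ∀ i, stickBreak β i ∈ Set.Icc (0 : ℝ) 1 := by
  filter_upwards [ae_pySticks_mem_Icc hd0 hd1 hα] with β hβ i
  exact ⟨stickBreak_nonneg hβ i, ENNReal.ofReal_le_one.1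
    ((ENNReal.le_tsum i).trans (tsum_ofReal_stickBreak_le_one hβ))⟩

lemma measurable_prod_mul_negMulLog {ι : Type*} [Fintype ι] (a : ι → ℝ) (k : ι) (e : ι ↪ ℕ) :
    Measurable fun β : ℕ → ℝ => (∏ i, ENNReal.ofReal (stickBreak β (e i)) ^ a i) *
      ENNReal.ofReal (Real.negMulLog (stickBreak β (e k))) :=
  (Finset.measurable_prod _ fun i _ =>
    (measurable_stickBreak_apply (e i)).ennreal_ofReal.pow_const _).mul
    (Real.continuous_negMulLog.measurable.comp (measurable_stickBreak_apply (e k))).ennreal_ofReal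

/-- The power `p ^ (1 + s)` raises the exponent of block `k` to `b k + s ≥ 1`, where the moment
formula applies and can be differentiated. Before that, `a k` may be `0`: this is the case of an
index outside the sample. The sign of the digamma difference comes from `m' ≤ 0` and `pyMoment > 0`,
without appeal to monotonicity of `psi0`. -/
lemma tsum_lintegral_prod_mul_negMulLog {d α : ℝ} (hd0 : 0 ≤ d) (hd1 : d < 1) (hα : -d < α)
    {ι : Type*} [Fintype ι] [DecidableEq ι] {a b : ι → ℝ} (ha : ∀ i, 0 ≤ a i) (k : ι)
    (hb : b = Function.update a k (a k + 1)) (hb1 : ∀ i, 1 ≤ b i) :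
    0 ≤ psi0 (α + ∑ i, b i) - psi0 (b k - d) ∧
    ∑' e : ι ↪ ℕ, ∫⁻ β, (∏ i, ENNReal.ofReal (stickBreak β (e i)) ^ a i) *
        ENNReal.ofReal (Real.negMulLog (stickBreak β (e k))) ∂pySticks d α =
      ENNReal.ofReal (pyMoment d α b * (psi0 (α + ∑ i, b i) - psi0 (b k - d))) := by
  have : Nonempty ι := ⟨k⟩
  have hB := one_le_sum_of_one_le hb1
  have hpos := pyMoment_pos hd0 hd1 hα hb1
  have : Countable (ι ↪ ℕ) := DFunLike.coe_injective.countable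
  have hbs : ∀ s, Function.update a k (a k + (1 + s)) = Function.update b k (b k + s) := by
    intro s
    rw [hb, Function.update_idem, Function.update_self, add_assoc]
  have hbs1 : ∀ s, 0 ≤ s → ∀ i, 1 ≤ Function.update b k (b k + s) i := by
    intro s hs i
    rcases eq_or_ne i k with rfl | hi
    · rw [Function.update_self]; linarith [hb1 i]
    · rw [Function.update_of_ne hi]; exact hb1 i
  have hmeas : ∀ e : ι ↪ ℕ, Measurable fun β : ℕ → ℝ =>
      ∏ i, ENNReal.ofReal (stickBreak β (e i)) ^ a i := fun e =>
    Finset.measurable_prod _ fun i _ =>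
      (measurable_stickBreak_apply (e i)).ennreal_ofReal.pow_const _
  have key := tsum_lintegral_mul_negMulLog (P := pySticks d α)
    (w := fun (e : ι ↪ ℕ) β => ∏ i, ENNReal.ofReal (stickBreak β (e i)) ^ a i) hmeas
    (p := fun e β => stickBreak β (e k)) (fun e => measurable_stickBreak_apply _)
    (fun e => by
      filter_upwards [ae_stickBreak_mem_Icc hd0 hd1 hα] with β hβ using hβ _)
    (hasDerivAt_Gamma_ratio (pyMoment d α b) (by linarith : 0 < α + ∑ i, b i)
      (by linarith [hb1 k] : 0 < b k - d))
    (fun s hs => by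
      rw [← pyMoment_update hd1 hα hb1 k s]
      exact (pyMoment_pos hd0 hd1 hα (hbs1 s hs.1)).le)
    (fun s hs => by
      have h1s : 0 ≤ 1 + s := by linarith [hs.1]
      rw [← pyMoment_update hd1 hα hb1 k s,
        ← lintegral_injSum_pySticks hd0 hd1 (hbs1 s hs.1) hα]
      unfold injSum
      rw [lintegral_tsum fun e => (Finset.measurable_prod _ fun i _ =>
        (measurable_stickBreak_apply (e i)).ennreal_ofReal.pow_const _).aemeasurable]
      refine tsum_congr fun e => lintegral_congr fun β => ?_
      rw [ofReal_rpow_add_prod (fun i => ENNReal.ofReal (stickBreak β (e i))) ha k h1s, hbs])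
  refine ⟨?_, ?_⟩
  · have := key.1
    by_contra hneg
    nlinarith [mul_pos hpos (by linarith : 0 < psi0 (b k - d) - psi0 (α + ∑ i, b i))]
  · rw [key.2]
    congr 1
    ring

/-- The entropy as an extended nonnegative real. -/
def entropyENN {ι : Type*} (π : ι → ℝ) : ℝ≥0∞ := ∑' i, ENNReal.ofReal (Real.negMulLog (π i))

lemma measurable_entropyENN {ι : Type*} [Countable ι] :
    Measurable (entropyENN : (ι → ℝ) → ℝ≥0∞) :=
  Measurable.tsum fun i =>
    (Real.continuous_negMulLog.measurable.comp (measurable_pi_apply i)).ennreal_ofReal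

/-- For each `e`, the entropy is split over the range of `e` and its complement. A choice of `e`
together with an index outside its range is an embedding of `Option ι`, with exponent `0` at `none`.
-/
lemma entropyENN_mul_injSum {ι : Type*} [Fintype ι] (w : ℕ → ℝ≥0∞) (p : ℕ → ℝ) (a : ι → ℝ) :
    entropyENN p * injSum w a =
      (∑ k, ∑' e : ι ↪ ℕ, (∏ i, w (e i) ^ a i) * ENNReal.ofReal (Real.negMulLog (p (e k)))) +
      ∑' e : Option ι ↪ ℕ, (∏ o, w (e o) ^ (o.elim 0 a : ℝ)) *
        ENNReal.ofReal (Real.negMulLog (p (e none))) := by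
  have hsplit : ∀ e : ι ↪ ℕ, entropyENN p =
      (∑ k, ENNReal.ofReal (Real.negMulLog (p (e k)))) +
      ∑' j : ↥(Set.range e)ᶜ, ENNReal.ofReal (Real.negMulLog (p j)) := by
    intro e
    rw [entropyENN, ← Summable.tsum_add_tsum_compl (s := Set.range e) ENNReal.summable
      ENNReal.summable, tsum_range (fun j => ENNReal.ofReal (Real.negMulLog (p j))) e.injective,
      tsum_fintype]
  rw [injSum, ← ENNReal.tsum_mul_left]
  have h1 : ∀ e : ι ↪ ℕ, entropyENN p * ∏ i, w (e i) ^ a i =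
      (∑ k, (∏ i, w (e i) ^ a i) * ENNReal.ofReal (Real.negMulLog (p (e k)))) +
      ∑' j : ↥(Set.range e)ᶜ, (∏ i, w (e i) ^ a i) * ENNReal.ofReal (Real.negMulLog (p j)) := by
    intro e
    rw [hsplit e, add_mul, Finset.sum_mul, ← ENNReal.tsum_mul_right]
    simp_rw [mul_comm]
  simp_rw [h1]
  rw [ENNReal.tsum_add, Summable.tsum_finsetSum fun _ _ => ENNReal.summable]
  congr 1
  rw [← (Function.Embedding.optionEmbeddingEquiv ι ℕ).symm.tsum_eq, ENNReal.tsum_sigma']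
  refine tsum_congr fun e => tsum_congr fun j => ?_
  simp [Fintype.prod_option]

/-- The posterior mean of the entropy, as a function of the counts. -/
def pyEntropyMean (d α : ℝ) {ι : Type*} [Fintype ι] (n : ι → ℝ) : ℝ :=
  psi0 (α + ∑ i, n i + 1) - (α + Fintype.card ι * d) / (α + ∑ i, n i) * psi0 (1 - d)
    - 1 / (α + ∑ i, n i) * ∑ i, (n i - d) * psi0 (n i - d + 1)

/-- The mean entropy of Pitman-Yor weights. -/
lemma lintegral_entropyENN_pySticks {d α : ℝ} (hd0 : 0 ≤ d) (hd1 : d < 1) (hα : -d < α) :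
    0 ≤ psi0 (α + 1) - psi0 (1 - d) ∧ ∫⁻ β, entropyENN (stickBreak β) ∂pySticks d α =
      ENNReal.ofReal (psi0 (α + 1) - psi0 (1 - d)) := by
  have h := tsum_lintegral_prod_mul_negMulLog hd0 hd1 hα (ι := Unit) (a := 0) (b := 1)
    (fun _ => le_rfl) () (by ext; simp) (fun _ => le_rfl)
  have h1 : pyMoment d α (1 : Unit → ℝ) = 1 := by
    have hΓ1 := (Real.Gamma_pos_of_pos (by linarith : 0 < 1 - d)).ne'
    have hΓ2 := (Real.Gamma_pos_of_pos (by linarith : 0 < α + 1)).ne'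
    simp [pyMoment, hΓ1, hΓ2]
  simp only [h1, Finset.univ_unique, Finset.sum_singleton, Pi.one_apply, one_mul,
    Finset.prod_singleton, Pi.zero_apply, ENNReal.rpow_zero] at h
  refine ⟨h.1, ?_⟩
  rw [← h.2]
  unfold entropyENN
  have hmeas : ∀ i, Measurable fun β : ℕ → ℝ =>
      ENNReal.ofReal (Real.negMulLog (stickBreak β i)) := fun i =>
    (Real.continuous_negMulLog.measurable.comp (measurable_stickBreak_apply i)).ennreal_ofReal
  rw [lintegral_tsum fun i => (hmeas i).aemeasurable,
    ← (Equiv.uniqueEmbeddingEquivResult (α := Unit) (β := ℕ)).tsum_eq]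
  rfl

/-- The mean of the entropy times the power sum over distinct indices. -/
lemma lintegral_entropyENN_mul_injSum {d α : ℝ} (hd0 : 0 ≤ d) (hd1 : d < 1) (hα : -d < α)
    {ι : Type*} [Fintype ι] [Nonempty ι] {n : ι → ℝ} (hn : ∀ i, 1 ≤ n i) :
    0 ≤ pyEntropyMean d α n ∧
    ∫⁻ β, entropyENN (stickBreak β) * injSum (fun j => ENNReal.ofReal (stickBreak β j)) n
        ∂pySticks d α =
      ENNReal.ofReal (pyMoment d α n * pyEntropyMean d α n) := by
  classical
  have hA := one_le_sum_of_one_le hn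
  have hpos := pyMoment_pos hd0 hd1 hα hn
  have hαA : 0 < α + ∑ i, n i := by linarith
  have : Countable (ι ↪ ℕ) := DFunLike.coe_injective.countable
  have : Countable (Option ι ↪ ℕ) := DFunLike.coe_injective.countable
  have hold : ∀ k, 0 ≤ psi0 (α + ∑ i, n i + 1) - psi0 (n k - d + 1) ∧
      ∑' e : ι ↪ ℕ, ∫⁻ β, (∏ i, ENNReal.ofReal (stickBreak β (e i)) ^ n i) *
        ENNReal.ofReal (Real.negMulLog (stickBreak β (e k))) ∂pySticks d α =
      ENNReal.ofReal (pyMoment d α n * ((n k - d) / (α + ∑ i, n i)) *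
        (psi0 (α + ∑ i, n i + 1) - psi0 (n k - d + 1))) := by
    intro k
    have h := tsum_lintegral_prod_mul_negMulLog hd0 hd1 hα
      (fun i => zero_le_one.trans (hn i)) k rfl (fun i => by
        rcases eq_or_ne i k with rfl | hi
        · rw [Function.update_self]; linarith [hn i]
        · rw [Function.update_of_ne hi]; exact hn i)
    rwa [sum_update_add, Function.update_self, pyMoment_update_add_one hd1 hα hn, ← add_assoc,
      show n k + 1 - d = n k - d + 1 by ring] at h
  -- A new index has exponent `0` in the power sum and exponent `1` once the entropy factor is
  -- counted.
  have hnew : 0 ≤ psi0 (α + ∑ i, n i + 1) - psi0 (1 - d) ∧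
      ∑' e : Option ι ↪ ℕ, ∫⁻ β, (∏ o, ENNReal.ofReal (stickBreak β (e o)) ^ (o.elim 0 n : ℝ)) *
        ENNReal.ofReal (Real.negMulLog (stickBreak β (e none))) ∂pySticks d α =
      ENNReal.ofReal (pyMoment d α n * ((α + Fintype.card ι * d) / (α + ∑ i, n i)) *
        (psi0 (α + ∑ i, n i + 1) - psi0 (1 - d))) := by
    have h := tsum_lintegral_prod_mul_negMulLog hd0 hd1 hα (ι := Option ι)
      (a := fun o => o.elim 0 n) (b := fun o => o.elim 1 n)
      (by rintro (_ | i); exacts [le_rfl, zero_le_one.trans (hn i)]) none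
      (by ext (_ | i) <;> simp) (by rintro (_ | i); exacts [le_rfl, hn i])
    rwa [pyMoment_option_one hd1 hα hn, Fintype.sum_option,
      show α + (Option.elim none 1 n + ∑ i, Option.elim (some i) 1 n) = α + ∑ i, n i + 1 by
        simp only [Option.elim_none, Option.elim_some]; ring] at h
  have hcard : 0 ≤ α + Fintype.card ι * d := by
    have : (1 : ℝ) ≤ Fintype.card ι := by exact_mod_cast Fintype.card_pos (α := ι)
    nlinarith
  have hnn1 : ∀ k ∈ Finset.univ, 0 ≤ pyMoment d α n * ((n k - d) / (α + ∑ i, n i)) *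
        (psi0 (α + ∑ i, n i + 1) - psi0 (n k - d + 1)) := fun k _ =>
    mul_nonneg (mul_nonneg hpos.le (div_nonneg (by linarith [hn k]) hαA.le)) (hold k).1
  have hnn2 : 0 ≤ pyMoment d α n * ((α + Fintype.card ι * d) / (α + ∑ i, n i)) *
        (psi0 (α + ∑ i, n i + 1) - psi0 (1 - d)) :=
    mul_nonneg (mul_nonneg hpos.le (div_nonneg hcard hαA.le)) hnew.1
  -- The numerators `n k - d` and `α + K d` add up to `α + ∑ n i`, so `psi0 (α + ∑ n i + 1)` enters
  -- with coefficient one.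
  have heq : pyMoment d α n * pyEntropyMean d α n =
      ∑ k, pyMoment d α n * ((n k - d) / (α + ∑ i, n i)) *
        (psi0 (α + ∑ i, n i + 1) - psi0 (n k - d + 1)) +
      pyMoment d α n * ((α + Fintype.card ι * d) / (α + ∑ i, n i)) *
        (psi0 (α + ∑ i, n i + 1) - psi0 (1 - d)) := by
    have h1 : ∑ k, pyMoment d α n * ((n k - d) / (α + ∑ i, n i)) *
        (psi0 (α + ∑ i, n i + 1) - psi0 (n k - d + 1)) = pyMoment d α n / (α + ∑ i, n i) *
        ((∑ i, n i - Fintype.card ι * d) * psi0 (α + ∑ i, n i + 1) -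
          ∑ i, (n i - d) * psi0 (n i - d + 1)) := by
      have h2 : ∑ i, n i - Fintype.card ι * d = ∑ i, (n i - d) := by
        simp [Finset.sum_sub_distrib]
      rw [h2, Finset.sum_mul, ← Finset.sum_sub_distrib, Finset.mul_sum]
      refine Finset.sum_congr rfl fun k _ => ?_
      ring
    rw [h1, pyEntropyMean]
    field_simp
    ring
  refine ⟨?_, ?_⟩
  · have := add_nonneg (Finset.sum_nonneg hnn1) hnn2
    rw [← heq] at this
    exact nonneg_of_mul_nonneg_right this hpos
  · simp_rw [entropyENN_mul_injSum]
    rw [lintegral_add_left (Finset.measurable_sum _ fun k _ =>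
        Measurable.tsum fun e => measurable_prod_mul_negMulLog n k e),
      lintegral_finsetSum _ fun k _ => Measurable.tsum fun e =>
        measurable_prod_mul_negMulLog n k e, heq,
      ENNReal.ofReal_add (Finset.sum_nonneg hnn1) hnn2, ENNReal.ofReal_sum_of_nonneg hnn1,
      lintegral_tsum fun e => (measurable_prod_mul_negMulLog _ _ e).aemeasurable, ← hnew.2]
    congr 1
    refine Finset.sum_congr rfl fun k _ => ?_
    rw [lintegral_tsum fun e => (measurable_prod_mul_negMulLog _ _ e).aemeasurable, (hold k).2]

/-! ### The entropy of random weights -/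

/-- No summability is required: for a divergent series both sides take the default value `0`. -/
lemma entropy_eq_toReal {ι : Type*} {p : ι → ℝ} (hp : ∀ i, p i ∈ Set.Icc (0 : ℝ) 1) :
    entropy p = (entropyENN p).toReal := by
  rw [entropy, entropyENN, ENNReal.tsum_toReal_eq fun _ => ENNReal.ofReal_ne_top]
  exact tsum_congr fun i => (ENNReal.toReal_ofReal (Real.negMulLog_nonneg (hp i).1 (hp i).2)).symm

lemma summable_negMulLog {ι : Type*} {p : ι → ℝ} (hp : ∀ i, p i ∈ Set.Icc (0 : ℝ) 1)
    (h : entropyENN p ≠ ∞) : Summable fun i => Real.negMulLog (p i) :=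
  (ENNReal.summable_toReal h).congr fun i =>
    ENNReal.toReal_ofReal (Real.negMulLog_nonneg (hp i).1 (hp i).2)

section
variable {ι T : Type*} [MeasurableSpace T] {μ : Measure T} {p : T → ι → ℝ}

lemma ae_summable_negMulLog [Countable ι] (hp : Measurable p)
    (hp01 : ∀ᵐ t ∂μ, ∀ i, p t i ∈ Set.Icc (0 : ℝ) 1)
    (h : ∫⁻ t, entropyENN (p t) ∂μ ≠ ∞) : ∀ᵐ t ∂μ, Summable fun i => Real.negMulLog (p t i) := by
  filter_upwards [hp01, ae_lt_top (measurable_entropyENN.comp hp) h] with t ht hfin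
  exact summable_negMulLog ht hfin.ne

lemma entropy_ae_eq_toReal (hp01 : ∀ᵐ t ∂μ, ∀ i, p t i ∈ Set.Icc (0 : ℝ) 1) :
    (fun t => entropy (p t)) =ᵐ[μ] fun t => (entropyENN (p t)).toReal := by
  filter_upwards [hp01] with t ht using entropy_eq_toReal ht

lemma integrable_entropy [Countable ι] (hp : Measurable p)
    (hp01 : ∀ᵐ t ∂μ, ∀ i, p t i ∈ Set.Icc (0 : ℝ) 1)
    (h : ∫⁻ t, entropyENN (p t) ∂μ ≠ ∞) : Integrable (fun t => entropy (p t)) μ :=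
  (integrable_congr (entropy_ae_eq_toReal hp01)).2
    (integrable_toReal_of_lintegral_ne_top (measurable_entropyENN.comp hp).aemeasurable h)

lemma integral_entropy [Countable ι] (hp : Measurable p)
    (hp01 : ∀ᵐ t ∂μ, ∀ i, p t i ∈ Set.Icc (0 : ℝ) 1)
    (h : ∫⁻ t, entropyENN (p t) ∂μ ≠ ∞) :
    ∫ t, entropy (p t) ∂μ = (∫⁻ t, entropyENN (p t) ∂μ).toReal := by
  rw [integral_congr_ae (entropy_ae_eq_toReal hp01)]
  exact integral_toReal (measurable_entropyENN.comp hp).aemeasurable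
    (ae_lt_top (measurable_entropyENN.comp hp) h)

end

/-! ### Means of Dirichlet vectors -/

section
variable {ι : Type*} [Fintype ι] {a : ι → ℝ}

lemma measurable_div_sum : Measurable fun (g : ι → ℝ) i => g i / ∑ k, g k := by
  rw [measurable_pi_iff]
  intro i
  fun_prop

lemma isProbabilityMeasure_dirichletMeasure (ha : ∀ i, 0 < a i) :
    IsProbabilityMeasure (dirichletMeasure a) := by
  have : ∀ i, IsProbabilityMeasure (gammaMeasure (a i) 1) :=
    fun i => isProbabilityMeasure_gammaMeasure (ha i) one_pos
  exact Measure.isProbabilityMeasure_map measurable_div_sum.aemeasurable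

lemma ae_dirichletMeasure_mem_Icc (ha : ∀ i, 0 < a i) :
    ∀ᵐ p ∂dirichletMeasure a, ∀ i, p i ∈ Set.Icc (0 : ℝ) 1 := by
  rw [ae_all_iff]
  intro i
  rw [dirichletMeasure, ae_map_iff measurable_div_sum.aemeasurable
    (measurable_pi_apply i measurableSet_Icc)]
  filter_upwards [ae_pos_pi_gammaMeasure ha] with g hg
  have hS : 0 < ∑ i, g i := Finset.sum_pos (fun i _ => hg i) ⟨i, Finset.mem_univ i⟩
  exact ⟨div_nonneg (hg i).le hS.le, (div_le_one hS).2
    (Finset.single_le_sum (fun j _ => (hg j).le) (Finset.mem_univ i))⟩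

/-- The Dirichlet moment in the form required by `hasDerivAt_Gamma_ratio`; the factor `a k / ∑ a i`
is the mean. -/
lemma lintegral_dirichletMeasure_one_add (ha : ∀ i, 0 < a i) (k : ι) {s : ℝ} (hs : 0 ≤ s) :
    ∫⁻ p, ENNReal.ofReal (p k) ^ (1 + s) ∂dirichletMeasure a =
      ENNReal.ofReal (a k / (∑ i, a i) *
        (Real.Gamma (∑ i, a i + 1) / Real.Gamma (∑ i, a i + 1 + s)) *
        (Real.Gamma (a k + 1 + s) / Real.Gamma (a k + 1))) := by
  have hA : 0 < ∑ i, a i := Finset.sum_pos (fun i _ => ha i) ⟨k, Finset.mem_univ k⟩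
  have hΓA := (Real.Gamma_pos_of_pos hA).ne'
  have hΓk := (Real.Gamma_pos_of_pos (ha k)).ne'
  have hk := (ha k).ne'
  rw [lintegral_dirichletMeasure_rpow ha k (by linarith : 0 < 1 + s),
    Real.Gamma_add_one hA.ne', Real.Gamma_add_one hk, ← add_assoc, ← add_assoc]
  congr 1
  field_simp

lemma lintegral_dirichletMeasure (ha : ∀ i, 0 < a i) (k : ι) :
    ∫⁻ p, ENNReal.ofReal (p k) ∂dirichletMeasure a = ENNReal.ofReal (a k / ∑ i, a i) := by
  have h := lintegral_dirichletMeasure_one_add ha k le_rfl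
  have hA : 0 < ∑ i, a i := Finset.sum_pos (fun i _ => ha i) ⟨k, Finset.mem_univ k⟩
  have hΓA := (Real.Gamma_pos_of_pos (by linarith : 0 < ∑ i, a i + 1)).ne'
  have hΓk := (Real.Gamma_pos_of_pos (by linarith [ha k] : 0 < a k + 1)).ne'
  simpa [hΓA, hΓk] using h

lemma lintegral_dirichletMeasure_negMulLog (ha : ∀ i, 0 < a i) (k : ι) :
    0 ≤ psi0 (∑ i, a i + 1) - psi0 (a k + 1) ∧
    ∫⁻ p, ENNReal.ofReal (Real.negMulLog (p k)) ∂dirichletMeasure a =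
      ENNReal.ofReal (a k / (∑ i, a i) * (psi0 (∑ i, a i + 1) - psi0 (a k + 1))) := by
  have hA : 0 < ∑ i, a i := Finset.sum_pos (fun i _ => ha i) ⟨k, Finset.mem_univ k⟩
  have hc : 0 < a k / ∑ i, a i := div_pos (ha k) hA
  have key := lintegral_mul_negMulLog (τ := dirichletMeasure a) (w := fun _ => 1)
    measurable_const (measurable_pi_apply k)
    (by filter_upwards [ae_dirichletMeasure_mem_Icc ha] with p hp using hp k)
    (hasDerivAt_Gamma_ratio (a k / ∑ i, a i) (by linarith : 0 < ∑ i, a i + 1)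
      (by linarith [ha k] : 0 < a k + 1))
    (fun s hs => mul_nonneg (mul_nonneg hc.le (div_nonneg
      (Real.Gamma_pos_of_pos (by linarith)).le (Real.Gamma_pos_of_pos (by linarith [hs.1])).le))
      (div_nonneg (Real.Gamma_pos_of_pos (by linarith [ha k, hs.1])).le
        (Real.Gamma_pos_of_pos (by linarith [ha k])).le))
    (fun s hs => by simpa using lintegral_dirichletMeasure_one_add ha k hs.1)
  simp only [one_mul] at key
  refine ⟨?_, ?_⟩
  · by_contra hneg
    nlinarith [key.1, mul_pos hc (by linarith : 0 < psi0 (a k + 1) - psi0 (∑ i, a i + 1))]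
  · rw [key.2]
    congr 1
    ring

end

/-! ### The mean entropy of the posterior vector -/

/-- The moment formula for one block of exponent `1`. The total mass is needed only in the mean, as
the factor of `-p_* log p_*` in the posterior entropy. -/
lemma lintegral_tsum_stickBreak {d α : ℝ} (hd0 : 0 ≤ d) (hd1 : d < 1) (hα : -d < α) :
    ∫⁻ β, ∑' j, ENNReal.ofReal (stickBreak β j) ∂pySticks d α = 1 := by
  have hΓ1 := (Real.Gamma_pos_of_pos (by linarith : 0 < 1 - d)).ne'
  have hΓ2 := (Real.Gamma_pos_of_pos (by linarith : 0 < α + 1)).ne'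
  have h := lintegral_injSum_pySticks hd0 hd1 (a := fun _ : Unit => 1) (fun _ => le_rfl) hα
  have h1 : pyMoment d α (fun _ : Unit => 1) = 1 := by simp [pyMoment, hΓ1, hΓ2]
  rw [h1, ENNReal.ofReal_one] at h
  rw [← h]
  refine lintegral_congr fun β => ?_
  rw [injSum, ← (Equiv.uniqueEmbeddingEquivResult (α := Unit) (β := ℕ)).tsum_eq]
  refine tsum_congr fun e => ?_
  simp
  rfl

lemma measurable_sumElim_weights (K : ℕ) : Measurable fun q : (Option (Fin K) → ℝ) × (ℕ → ℝ) =>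
    (Sum.elim (fun i => q.1 (some i)) (fun j => q.1 none * q.2 j) : Fin K ⊕ ℕ → ℝ) := by
  rw [measurable_pi_iff]
  rintro (i | j)
  · exact (measurable_pi_apply _).comp measurable_fst
  · exact ((measurable_pi_apply _).comp measurable_fst).mul
      ((measurable_pi_apply _).comp measurable_snd)

/-- The chain rule for entropy, from `-xy log (xy) = y (-x log x) + x (-y log y)`. The total mass of
`w` is kept as a factor because `w` is not assumed to sum to one. -/
lemma entropyENN_sumElim {K : ℕ} {p : Option (Fin K) → ℝ} {w : ℕ → ℝ}
    (hp : p none ∈ Set.Icc (0 : ℝ) 1) (hw : ∀ j, w j ∈ Set.Icc (0 : ℝ) 1) :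
    entropyENN (Sum.elim (fun i => p (some i)) (fun j => p none * w j)) =
      ∑ i, ENNReal.ofReal (Real.negMulLog (p (some i))) +
      (ENNReal.ofReal (Real.negMulLog (p none)) * ∑' j, ENNReal.ofReal (w j) +
        ENNReal.ofReal (p none) * entropyENN w) := by
  rw [entropyENN, Summable.tsum_sum ENNReal.summable ENNReal.summable, tsum_fintype, entropyENN,
    ← ENNReal.tsum_mul_left, ← ENNReal.tsum_mul_left, ← ENNReal.tsum_add]
  congr 1
  refine tsum_congr fun j => ?_
  have h1 := Real.negMulLog_nonneg hp.1 hp.2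
  have h2 := Real.negMulLog_nonneg (hw j).1 (hw j).2
  rw [Sum.elim_inr, Real.negMulLog_mul, ENNReal.ofReal_add (mul_nonneg (hw j).1 h1)
    (mul_nonneg hp.1 h2), ENNReal.ofReal_mul (hw j).1, ENNReal.ofReal_mul hp.1, mul_comm]

lemma ae_pyMeasure_mem_Icc {d α : ℝ} (hd0 : 0 ≤ d) (hd1 : d < 1) (hα : -d < α) :
    ∀ᵐ w ∂pyMeasure d α, ∀ i, w i ∈ Set.Icc (0 : ℝ) 1 := by
  rw [ae_all_iff]
  intro i
  rw [pyMeasure_eq_map, ae_map_iff measurable_stickBreak.aemeasurable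
    (measurable_pi_apply i measurableSet_Icc)]
  filter_upwards [ae_stickBreak_mem_Icc hd0 hd1 hα] with β hβ using hβ i

lemma lintegral_prod_add_mul_add_mul {S T : Type*} [MeasurableSpace S] [MeasurableSpace T]
    (μ : Measure S) (ν : Measure T) [SFinite μ] [IsProbabilityMeasure ν] {f f₁ f₂ : S → ℝ≥0∞}
    {g₁ g₂ : T → ℝ≥0∞} (hf : Measurable f) (hf₁ : Measurable f₁) (hg₁ : Measurable g₁)
    (hf₂ : Measurable f₂) (hg₂ : Measurable g₂) :
    ∫⁻ q, (f q.1 + (f₁ q.1 * g₁ q.2 + f₂ q.1 * g₂ q.2)) ∂μ.prod ν =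
      ∫⁻ x, f x ∂μ +
        ((∫⁻ x, f₁ x ∂μ) * ∫⁻ y, g₁ y ∂ν + (∫⁻ x, f₂ x ∂μ) * ∫⁻ y, g₂ y ∂ν) := by
  rw [lintegral_add_left (by fun_prop), lintegral_add_left (by fun_prop),
    lintegral_prod_mul hf₁.aemeasurable hg₁.aemeasurable,
    lintegral_prod_mul hf₂.aemeasurable hg₂.aemeasurable]
  congr 1
  simpa using lintegral_prod_mul (μ := μ) (ν := ν) hf.aemeasurable
    (aemeasurable_const (b := (1 : ℝ≥0∞)))

/-- By independence the chain rule may be integrated factor by factor. The Dirichlet weight of `p_*`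
is `α + K d`, so the term `psi0 (α + K d + 1)` in the mean of `-p_* log p_*` cancels against the one
in the mean entropy of `PY(d, α + K d)`. -/
theorem lintegral_entropyENN_pyPosterior {d α : ℝ} (hd0 : 0 ≤ d) (hd1 : d < 1) (hα : -d < α)
    {K : ℕ} (hK : 1 ≤ K) {n : Fin K → ℕ} (hn : ∀ i, 1 ≤ n i) :
    0 ≤ pyEntropyMean d α (fun i => (n i : ℝ)) ∧
    (∀ᵐ w ∂pyPosterior d α n, ∀ i, w i ∈ Set.Icc (0 : ℝ) 1) ∧
    ∫⁻ w, entropyENN w ∂pyPosterior d α n =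
      ENNReal.ofReal (pyEntropyMean d α (fun i => (n i : ℝ))) := by
  have : Nonempty (Fin K) := ⟨⟨0, hK⟩⟩
  have hn' : ∀ i, (1 : ℝ) ≤ n i := fun i => by exact_mod_cast hn i
  have hK' : (1 : ℝ) ≤ K := by exact_mod_cast hK
  have hα' : 0 < α + K * d := by nlinarith
  have hαd : -d < α + K * d := by linarith
  set a : Option (Fin K) → ℝ := fun o => o.elim (α + K * d) fun i => (n i : ℝ) - d with hadef
  have ha : ∀ o, 0 < a o := by
    rintro (_ | i)
    · exact hα'
    · simp only [a, Option.elim_some]; linarith [hn' i]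
  have hA : ∑ o, a o = α + ∑ i, (n i : ℝ) := by
    simp only [a, Fintype.sum_option, Option.elim_none, Option.elim_some, Finset.sum_sub_distrib,
      Finset.sum_const, Finset.card_univ, Fintype.card_fin, nsmul_eq_mul]
    ring
  have hApos : 0 < ∑ o, a o := Finset.sum_pos (fun o _ => ha o) ⟨none, Finset.mem_univ _⟩
  have := isProbabilityMeasure_dirichletMeasure ha
  have := isProbabilityMeasure_pyMeasure hd0 hd1 hαd
  have := isProbabilityMeasure_pySticks hd0 hd1 hαd
  have h01 : ∀ᵐ q ∂(dirichletMeasure a).prod (pyMeasure d (α + K * d)),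
      (∀ o, q.1 o ∈ Set.Icc (0 : ℝ) 1) ∧ ∀ j, q.2 j ∈ Set.Icc (0 : ℝ) 1 := by
    have h1 := Measure.quasiMeasurePreserving_fst (μ := dirichletMeasure a)
      (ν := pyMeasure d (α + K * d)) |>.ae (ae_dirichletMeasure_mem_Icc ha)
    have h2 := Measure.quasiMeasurePreserving_snd (μ := dirichletMeasure a)
      (ν := pyMeasure d (α + K * d)) |>.ae (ae_pyMeasure_mem_Icc hd0 hd1 hαd)
    filter_upwards [h1, h2] with q hq1 hq2 using ⟨hq1, hq2⟩
  have hsum : ∫⁻ w, ∑' j, ENNReal.ofReal (w j) ∂pyMeasure d (α + K * d) = 1 := by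
    rw [pyMeasure_eq_map, lintegral_map (Measurable.tsum fun j =>
      (measurable_pi_apply j).ennreal_ofReal) measurable_stickBreak,
      lintegral_tsum_stickBreak hd0 hd1 hαd]
  have hH := lintegral_entropyENN_pySticks hd0 hd1 hαd
  have hent : ∫⁻ w, entropyENN w ∂pyMeasure d (α + K * d) =
      ENNReal.ofReal (psi0 (α + K * d + 1) - psi0 (1 - d)) := by
    rw [pyMeasure_eq_map, lintegral_map measurable_entropyENN measurable_stickBreak, hH.2]
  have hD := lintegral_dirichletMeasure_negMulLog ha
  have hnn1 : ∀ i ∈ Finset.univ, 0 ≤ a (some i) / (∑ o, a o) *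
      (psi0 (∑ o, a o + 1) - psi0 (a (some i) + 1)) := fun i _ =>
    mul_nonneg (div_nonneg (ha _).le hApos.le) (hD _).1
  have hnn2 : 0 ≤ a none / (∑ o, a o) * (psi0 (∑ o, a o + 1) - psi0 (a none + 1)) :=
    mul_nonneg (div_nonneg (ha _).le hApos.le) (hD _).1
  have hnn3 : 0 ≤ a none / (∑ o, a o) * (psi0 (α + K * d + 1) - psi0 (1 - d)) :=
    mul_nonneg (div_nonneg (ha _).le hApos.le) hH.1
  have heq : pyEntropyMean d α (fun i => (n i : ℝ)) =
      ∑ i, a (some i) / (∑ o, a o) * (psi0 (∑ o, a o + 1) - psi0 (a (some i) + 1)) +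
      (a none / (∑ o, a o) * (psi0 (∑ o, a o + 1) - psi0 (a none + 1)) +
        a none / (∑ o, a o) * (psi0 (α + K * d + 1) - psi0 (1 - d))) := by
    have hA' : α + ∑ i, (n i : ℝ) ≠ 0 := by rw [← hA]; exact hApos.ne'
    have h1 : ∑ i, a (some i) / (∑ o, a o) * (psi0 (∑ o, a o + 1) - psi0 (a (some i) + 1)) =
        1 / (∑ o, a o) * ((∑ i, (n i : ℝ) - K * d) * psi0 (∑ o, a o + 1) -
          ∑ i, ((n i : ℝ) - d) * psi0 ((n i : ℝ) - d + 1)) := by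
      have h2 : ∑ i, (n i : ℝ) - K * d = ∑ i, ((n i : ℝ) - d) := by
        simp [Finset.sum_sub_distrib]
      rw [h2, Finset.sum_mul, ← Finset.sum_sub_distrib, Finset.mul_sum]
      refine Finset.sum_congr rfl fun k _ => ?_
      simp only [a, Option.elim_some]
      ring
    rw [h1, hA, pyEntropyMean, Fintype.card_fin]
    simp only [a, Option.elim_none]
    field_simp
    ring
  refine ⟨?_, ?_, ?_⟩
  · rw [heq]
    exact add_nonneg (Finset.sum_nonneg hnn1) (add_nonneg hnn2 hnn3)
  · rw [ae_all_iff]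
    intro i
    rw [pyPosterior, ae_map_iff (measurable_sumElim_weights K).aemeasurable
      (measurable_pi_apply i measurableSet_Icc)]
    filter_upwards [h01] with q hq
    rcases i with i | j
    · exact hq.1 _
    · exact ⟨mul_nonneg (hq.1 _).1 (hq.2 j).1, mul_le_one₀ (hq.1 _).2 (hq.2 j).1 (hq.2 j).2⟩
  · have hm0 : ∀ o, Measurable fun p : Option (Fin K) → ℝ =>
        ENNReal.ofReal (Real.negMulLog (p o)) := fun o =>
      (Real.continuous_negMulLog.measurable.comp (measurable_pi_apply o)).ennreal_ofReal
    have hm1 : Measurable fun p : Option (Fin K) → ℝ =>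
        ∑ i, ENNReal.ofReal (Real.negMulLog (p (some i))) :=
      Finset.measurable_sum _ fun i _ => hm0 (some i)
    have hm3 : Measurable fun p : Option (Fin K) → ℝ => ENNReal.ofReal (p none) :=
      (measurable_pi_apply _).ennreal_ofReal
    have hm4 : Measurable fun w : ℕ → ℝ => ∑' j, ENNReal.ofReal (w j) :=
      Measurable.tsum fun j => (measurable_pi_apply j).ennreal_ofReal
    rw [pyPosterior, lintegral_map measurable_entropyENN (measurable_sumElim_weights K),
      lintegral_congr_ae (h01.mono fun q hq => entropyENN_sumElim (hq.1 none) hq.2),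
      lintegral_prod_add_mul_add_mul _ _ hm1 (hm0 none) hm4 hm3 measurable_entropyENN, hsum, hent,
      mul_one,
      (hD none).2, lintegral_dirichletMeasure ha none,
      ← ENNReal.ofReal_mul (div_nonneg (ha _).le hApos.le), ← ENNReal.ofReal_add hnn2 hnn3,
      lintegral_finsetSum _ fun i _ => hm0 (some i),
      Finset.sum_congr rfl fun i _ => (hD (some i)).2, ← ENNReal.ofReal_sum_of_nonneg hnn1,
      ← ENNReal.ofReal_add (Finset.sum_nonneg hnn1) (add_nonneg hnn2 hnn3), heq]

/-! ### The joint law of the weights and the observations -/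

lemma discreteMeasure_apply {X : Type*} [MeasurableSpace X] (w : ℕ → ℝ) (φ : ℕ → X) {B : Set X}
    (hB : MeasurableSet B) :
    discreteMeasure w φ B = ∑' i, ENNReal.ofReal (w i) * B.indicator 1 (φ i) := by
  rw [discreteMeasure, Measure.sum_apply _ hB]
  exact tsum_congr fun i => by rw [Measure.smul_apply, Measure.dirac_apply' _ hB, smul_eq_mul]

/-- The law of `(φ (z j))_j` for i.i.d. `φ_i ∼ ν`. -/
def atomLaw {κ ι X : Type*} [MeasurableSpace X] (ν : Measure X) (z : ι → κ) : Measure (ι → X) :=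
  (Measure.infinitePi fun _ : κ => ν).map fun φ j => φ (z j)

section
variable {κ ι X : Type*} [MeasurableSpace X] (ν : Measure X)

lemma measurable_comp_index (z : ι → κ) : Measurable fun (φ : κ → X) j => φ (z j) :=
  measurable_pi_iff.2 fun j => measurable_pi_apply (z j)

lemma atomLaw_pi [Fintype ι] (z : ι → κ) {B : ι → Set X} (hB : ∀ j, MeasurableSet (B j)) :
    atomLaw ν z (Set.univ.pi B) =
      ∫⁻ φ, ∏ j, (B j).indicator (1 : X → ℝ≥0∞) (φ (z j)) ∂Measure.infinitePi fun _ : κ => ν := by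
  have hpi := MeasurableSet.univ_pi hB
  rw [atomLaw, Measure.map_apply (measurable_comp_index z) hpi,
    ← lintegral_indicator_one (measurable_comp_index z hpi)]
  refine lintegral_congr fun φ => ?_
  by_cases h : ∀ j, φ (z j) ∈ B j
  · rw [Set.indicator_of_mem (by simpa using h)]
    simp [h]
  · rw [Set.indicator_of_notMem (by simpa using h)]
    push Not at h
    obtain ⟨j, hj⟩ := h
    exact (Finset.prod_eq_zero (Finset.mem_univ j) (Set.indicator_of_notMem hj _)).symm

variable [IsProbabilityMeasure ν]

instance isProbabilityMeasure_atomLaw (z : ι → κ) : IsProbabilityMeasure (atomLaw ν z) :=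
  Measure.isProbabilityMeasure_map (measurable_comp_index z).aemeasurable

lemma infinitePi_map_comp_injective {e : ι → κ} (he : Function.Injective e) :
    atomLaw ν e = Measure.infinitePi fun _ : ι => ν := by
  have h := (iIndepFun_infinitePi (P := fun _ : κ => ν) (X := fun _ x => x)
    fun _ => measurable_id).precomp he
  rw [atomLaw, h.map_fun_eq_infinitePi_map fun i => measurable_pi_apply (e i)]
  congr 1
  funext i
  exact Measure.infinitePi_map_eval (fun _ : κ => ν) (e i)

/-- Relabelling the atoms injectively does not change their joint law, so the law of the observed
symbols depends on the index assignment only through its partition. -/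
lemma atomLaw_comp_injective {e : ι → κ} (he : Function.Injective e) {T : Type*} (g : T → ι) :
    atomLaw ν (e ∘ g) = atomLaw ν g := by
  rw [atomLaw, atomLaw, ← infinitePi_map_comp_injective ν he, atomLaw,
    Measure.map_map (measurable_comp_index g) (measurable_comp_index e)]
  rfl

/-- Two different coordinates are independent with law `ν`, and the diagonal is null by Fubini, its
slices being singletons. There are countably many pairs of coordinates. -/
lemma ae_injective_infinitePi [StandardBorelSpace X] [NullSingletonClass ν] [Countable ι] :
    ∀ᵐ φ ∂Measure.infinitePi fun _ : ι => ν, Function.Injective φ := by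
  have h : ∀ i j : ι, i ≠ j → ∀ᵐ φ ∂Measure.infinitePi fun _ : ι => ν, φ i ≠ φ j := by
    intro i j hij
    have hind := (iIndepFun_infinitePi (P := fun _ : ι => ν) (X := fun _ x => x)
      fun _ => measurable_id).indepFun hij
    rw [indepFun_iff_map_prod_eq_prod_map_map (measurable_pi_apply i).aemeasurable
      (measurable_pi_apply j).aemeasurable] at hind
    have h1 : (Measure.infinitePi fun _ : ι => ν).map (fun φ => φ i) = ν :=
      Measure.infinitePi_map_eval (fun _ : ι => ν) i
    have h2 : (Measure.infinitePi fun _ : ι => ν).map (fun φ => φ j) = ν :=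
      Measure.infinitePi_map_eval (fun _ : ι => ν) j
    rw [h1, h2] at hind
    have hdiag : ∀ᵐ q ∂ν.prod ν, q.1 ≠ q.2 := by
      have hm : MeasurableSet {q : X × X | q.1 = q.2} := measurableSet_eq_fun measurable_fst
        measurable_snd
      rw [ae_iff]
      simp only [not_not]
      rw [Measure.measure_prod_null hm]
      refine ae_of_all _ fun x => ?_
      have : Prod.mk x ⁻¹' {q : X × X | q.1 = q.2} = {x} := by
        ext y
        simp [eq_comm]
      change ν (Prod.mk x ⁻¹' {q : X × X | q.1 = q.2}) = 0
      rw [this]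
      exact measure_singleton x
    rw [← hind] at hdiag
    exact ae_of_ae_map ((measurable_pi_apply i).prodMk (measurable_pi_apply j)).aemeasurable hdiag
  have h' : ∀ᵐ φ ∂Measure.infinitePi fun _ : ι => ν, ∀ i j : ι, i ≠ j → φ i ≠ φ j := by
    simp only [ae_all_iff]
    exact h
  filter_upwards [h'] with φ hφ i j hij
  by_contra hne
  exact hφ i j hne hij

end

section
variable {Ω X : Type*} [MeasurableSpace Ω] [MeasurableSpace X] {μ : Measure Ω}
  {ν : Measure X} [IsProbabilityMeasure ν] {N : ℕ} {d α : ℝ}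
  {π : Ω → ℕ → ℝ} {φ : Ω → ℕ → X} {x : Ω → Fin N → X}

lemma IsPYSample.map_weights (h : IsPYSample d α ν π φ x μ) : μ.map π = pyMeasure d α := by
  have h1 := congrArg (Measure.map Prod.fst) h.prior
  rw [Measure.map_map measurable_fst (h.measurable_weights.prodMk h.measurable_atoms)] at h1
  have h2 : Measure.map Prod.fst ((pyMeasure d α).prod (Measure.infinitePi fun _ : ℕ => ν)) =
      pyMeasure d α := by rw [Measure.map_fst_prod]; simp
  rw [h2] at h1
  exact h1

lemma IsPYSample.ae_weights_mem_Icc (h : IsPYSample d α ν π φ x μ) (hd0 : 0 ≤ d) (hd1 : d < 1)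
    (hα : -d < α) : ∀ᵐ ω ∂μ, ∀ i, π ω i ∈ Set.Icc (0 : ℝ) 1 := by
  have h1 := ae_pyMeasure_mem_Icc hd0 hd1 hα
  rw [← h.map_weights] at h1
  exact ae_of_ae_map h.measurable_weights.aemeasurable h1

lemma ae_tsum_ofReal_pyMeasure_le_one (hd0 : 0 ≤ d) (hd1 : d < 1) (hα : -d < α) :
    ∀ᵐ w ∂pyMeasure d α, ∑' i, ENNReal.ofReal (w i) ≤ 1 := by
  have hm : Measurable fun w : ℕ → ℝ => ∑' j, ENNReal.ofReal (w j) :=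
    Measurable.tsum fun j => (measurable_pi_apply j).ennreal_ofReal
  rw [pyMeasure_eq_map, ae_map_iff measurable_stickBreak.aemeasurable
    (measurableSet_le hm measurable_const)]
  filter_upwards [ae_pySticks_mem_Icc hd0 hd1 hα] with β hβ
    using tsum_ofReal_stickBreak_le_one hβ

variable [IsProbabilityMeasure μ]

/-- The sampling condition is integrated over `π ⁻¹' A`, an event of the conditioning σ-algebra, and
moved from real to extended nonnegative integrals. -/
lemma IsPYSample.measure_inter (h : IsPYSample d α ν π φ x μ) (hd0 : 0 ≤ d) (hd1 : d < 1)
    (hα : -d < α) {A : Set (ℕ → ℝ)} (hA : MeasurableSet A) {B : Fin N → Set X}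
    (hB : ∀ j, MeasurableSet (B j)) :
    μ (π ⁻¹' A ∩ x ⁻¹' Set.univ.pi B) =
      ∫⁻ ω in π ⁻¹' A, ∏ j, discreteMeasure (π ω) (φ ω) (B j) ∂μ := by
  have hpair : Measurable fun ω => (π ω, φ ω) := h.measurable_weights.prodMk h.measurable_atoms
  have hm := hpair.comap_le
  have hE : MeasurableSet {ω | ∀ j, x ω j ∈ B j} := by
    have := h.measurable_obs (MeasurableSet.univ_pi hB)
    simpa [Set.preimage, Set.mem_pi] using this
  have hE' : x ⁻¹' Set.univ.pi B = {ω | ∀ j, x ω j ∈ B j} := by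
    ext ω
    simp
  have hAm : MeasurableSet[MeasurableSpace.comap (fun ω => (π ω, φ ω)) inferInstance] (π ⁻¹' A) :=
    ⟨Prod.fst ⁻¹' A, measurable_fst hA, rfl⟩
  -- Finiteness ensures that `.real` loses nothing: an infinite mass would be read as `0`.
  have hfin : ∀ᵐ ω ∂μ, ∀ j, discreteMeasure (π ω) (φ ω) (B j) ≠ ∞ := by
    have h1 := ae_tsum_ofReal_pyMeasure_le_one hd0 hd1 hα
    rw [← h.map_weights] at h1
    filter_upwards [ae_of_ae_map h.measurable_weights.aemeasurable h1] with ω hω j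
    rw [discreteMeasure_apply _ _ (hB j)]
    refine ne_top_of_le_ne_top ENNReal.one_ne_top (le_trans (ENNReal.tsum_le_tsum fun i => ?_) hω)
    refine mul_le_of_le_one_right' ?_
    by_cases hi : φ ω i ∈ B j <;> simp [hi]
  have hint : Integrable ({ω | ∀ j, x ω j ∈ B j}.indicator fun _ => (1 : ℝ)) μ :=
    (integrable_const 1).indicator hE
  have hcond := setIntegral_condExp hm hint hAm
  have hsamp := h.sampling B hB
  have hint2 : Integrable (fun ω => ∏ j, (discreteMeasure (π ω) (φ ω)).real (B j)) μ :=
    integrable_condExp.congr hsamp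
  rw [setIntegral_congr_ae₀ (hm _ hAm).nullMeasurableSet
    (g := fun ω => ∏ j, (discreteMeasure (π ω) (φ ω)).real (B j))
    (hsamp.mono fun ω hω _ => hω), setIntegral_indicator hE] at hcond
  simp only [integral_const, MeasurableSet.univ, measureReal_restrict_apply, Set.univ_inter,
    smul_eq_mul, mul_one] at hcond
  rw [hE', ← ENNReal.ofReal_toReal (measure_ne_top μ _), ← measureReal_def, ← hcond,
    ofReal_integral_eq_lintegral_ofReal hint2.integrableOn
      (ae_of_all _ fun ω => Finset.prod_nonneg fun j _ => measureReal_nonneg)]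
  refine lintegral_congr_ae (ae_restrict_of_ae ?_)
  filter_upwards [hfin] with ω hω
  rw [ENNReal.ofReal_prod_of_nonneg fun j _ => measureReal_nonneg]
  exact Finset.prod_congr rfl fun j _ => ENNReal.ofReal_toReal (hω j)

/-- The joint law of weights and observations, a mixture over the indices of the observed atoms. -/
theorem IsPYSample.map_weights_obs (h : IsPYSample d α ν π φ x μ) (hd0 : 0 ≤ d) (hd1 : d < 1)
    (hα : -d < α) :
    μ.map (fun ω => (π ω, x ω)) = Measure.sum fun z : Fin N → ℕ =>
      ((pyMeasure d α).withDensity fun w => ∏ j, ENNReal.ofReal (w (z j))).prod (atomLaw ν z) := by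
  have := isProbabilityMeasure_pyMeasure hd0 hd1 hα
  have hπx : Measurable fun ω => (π ω, x ω) := h.measurable_weights.prodMk h.measurable_obs
  have hπφ : Measurable fun ω => (π ω, φ ω) := h.measurable_weights.prodMk h.measurable_atoms
  have hw : ∀ z : Fin N → ℕ, Measurable fun w : ℕ → ℝ => ∏ j, ENNReal.ofReal (w (z j)) :=
    fun z => Finset.measurable_prod _ fun j _ => (measurable_pi_apply _).ennreal_ofReal
  have hbox : ∀ (A : Set (ℕ → ℝ)) (B : Fin N → Set X), MeasurableSet A →
      (∀ j, MeasurableSet (B j)) → μ.map (fun ω => (π ω, x ω)) (A ×ˢ Set.univ.pi B) =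
      (Measure.sum fun z : Fin N → ℕ => ((pyMeasure d α).withDensity fun w =>
        ∏ j, ENNReal.ofReal (w (z j))).prod (atomLaw ν z)) (A ×ˢ Set.univ.pi B) := by
    intro A B hA hB
    have hAB := hA.prod (MeasurableSet.univ_pi hB)
    have hind : ∀ j (i : ℕ), Measurable fun q : (ℕ → ℝ) × (ℕ → X) =>
        (B j).indicator (1 : X → ℝ≥0∞) (q.2 i) := fun j i =>
      (measurable_one.indicator (hB j)).comp ((measurable_pi_apply i).comp measurable_snd)
    have hind' : ∀ z : Fin N → ℕ, Measurable fun φ : ℕ → X =>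
        ∏ j, (B j).indicator (1 : X → ℝ≥0∞) (φ (z j)) := fun z =>
      Finset.measurable_prod _ fun j _ =>
        (measurable_one.indicator (hB j)).comp (measurable_pi_apply _)
    have hpre : (fun ω => (π ω, x ω)) ⁻¹' (A ×ˢ Set.univ.pi B) =
        π ⁻¹' A ∩ x ⁻¹' Set.univ.pi B := rfl
    have hA1 : Measurable (A.indicator (1 : (ℕ → ℝ) → ℝ≥0∞)) := measurable_one.indicator hA
    -- A product of `N` mixtures over indices expands into a sum over assignments `z` of an index to
    -- each observation.
    have hsum : ∀ q : (ℕ → ℝ) × (ℕ → X),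
        A.indicator (1 : (ℕ → ℝ) → ℝ≥0∞) q.1 *
          ∏ j, ∑' i, ENNReal.ofReal (q.1 i) * (B j).indicator 1 (q.2 i) =
        ∑' z : Fin N → ℕ, (A.indicator (1 : (ℕ → ℝ) → ℝ≥0∞) q.1 *
          ∏ j, ENNReal.ofReal (q.1 (z j))) * ∏ j, (B j).indicator 1 (q.2 (z j)) := by
      intro q
      rw [← ENNReal.tsum_pi_prod_fin (fun j i =>
        ENNReal.ofReal (q.1 i) * (B j).indicator 1 (q.2 i)), ← ENNReal.tsum_mul_left]
      refine tsum_congr fun z => ?_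
      rw [Finset.prod_mul_distrib, mul_assoc]
    have hF : Measurable fun q : (ℕ → ℝ) × (ℕ → X) => A.indicator (1 : (ℕ → ℝ) → ℝ≥0∞) q.1 *
        ∏ j, ∑' i, ENNReal.ofReal (q.1 i) * (B j).indicator 1 (q.2 i) :=
      (hA1.comp measurable_fst).mul (Finset.measurable_prod _ fun j _ => Measurable.tsum fun i =>
        (((measurable_pi_apply i).comp measurable_fst).ennreal_ofReal).mul (hind j i))
    rw [Measure.map_apply hπx hAB, hpre, h.measure_inter hd0 hd1 hα hA hB,
      ← lintegral_indicator (h.measurable_weights hA)]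
    have hrw : ∀ ω, (π ⁻¹' A).indicator
        (fun ω => ∏ j, discreteMeasure (π ω) (φ ω) (B j)) ω =
        (fun q : (ℕ → ℝ) × (ℕ → X) => A.indicator (1 : (ℕ → ℝ) → ℝ≥0∞) q.1 *
          ∏ j, ∑' i, ENNReal.ofReal (q.1 i) * (B j).indicator 1 (q.2 i)) (π ω, φ ω) := by
      intro ω
      by_cases hω : π ω ∈ A
      · rw [Set.indicator_of_mem (show ω ∈ π ⁻¹' A from hω)]
        simp [hω, discreteMeasure_apply _ _ (hB _)]
      · rw [Set.indicator_of_notMem (show ω ∉ π ⁻¹' A from hω)]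
        simp [hω]
    simp_rw [hrw]
    rw [← lintegral_map hF hπφ, h.prior]
    simp_rw [hsum]
    have hmz : ∀ z : Fin N → ℕ, Measurable fun q : (ℕ → ℝ) × (ℕ → X) =>
        (A.indicator (1 : (ℕ → ℝ) → ℝ≥0∞) q.1 * ∏ j, ENNReal.ofReal (q.1 (z j))) *
          ∏ j, (B j).indicator 1 (q.2 (z j)) := fun z =>
      ((hA1.mul (hw z)).comp measurable_fst).mul ((hind' z).comp measurable_snd)
    rw [lintegral_tsum fun z => (hmz z).aemeasurable, Measure.sum_apply _ hAB]
    refine tsum_congr fun z => ?_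
    rw [lintegral_prod_mul (f := fun w => A.indicator (1 : (ℕ → ℝ) → ℝ≥0∞) w *
        ∏ j, ENNReal.ofReal (w (z j))) (g := fun φ : ℕ → X => ∏ j, (B j).indicator 1 (φ (z j)))
        (hA1.mul (hw z)).aemeasurable (hind' z).aemeasurable, Measure.prod_prod,
      withDensity_apply _ hA, ← lintegral_indicator hA, atomLaw_pi ν z hB]
    congr 1
    refine lintegral_congr fun w => ?_
    by_cases hwA : w ∈ A <;> simp [hwA]
  have : IsProbabilityMeasure (μ.map fun ω => (π ω, x ω)) :=
    Measure.isProbabilityMeasure_map hπx.aemeasurable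
  -- Boxes form a π-system that generates the product σ-algebra, and the box with all factors full
  -- compares the total masses.
  refine ext_of_generate_finite _ (generateFrom_eq_prod
    MeasurableSpace.generateFrom_measurableSet generateFrom_pi
    isCountablySpanning_measurableSet ?_).symm
    (MeasurableSpace.isPiSystem_measurableSet.prod isPiSystem_pi) ?_ ?_
  · exact ⟨fun _ => Set.univ, fun _ => ⟨fun _ => Set.univ, by simp, by simp⟩, Set.iUnion_const _⟩
  · rintro _ ⟨A, hA, _, ⟨B, hB, rfl⟩, rfl⟩
    exact hbox A B hA fun j => hB j (Set.mem_univ j)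
  · have := hbox Set.univ (fun _ => Set.univ) MeasurableSet.univ fun _ => MeasurableSet.univ
    simpa using this

end

/-! ### The partition generated by a sample -/

open scoped Classical in
/-- The number of elements of a block of a partition. -/
def blockSize {ι : Type*} [Fintype ι] (r : Setoid ι) (q : Quotient r) : ℕ :=
  (Finset.univ.filter fun j => (Quotient.mk r j) = q).card

lemma one_le_blockSize {ι : Type*} [Fintype ι] (r : Setoid ι) (q : Quotient r) :
    1 ≤ blockSize r q := by
  classical
  induction q using Quotient.inductionOn with
  | h j => exact Finset.card_pos.2 ⟨j, by simp⟩

section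
open scoped Classical
variable {ι : Type*} [Fintype ι]

lemma sum_blockSize (r : Setoid ι) : ∑ q, blockSize r q = Fintype.card ι :=
  (Finset.card_eq_sum_card_fiberwise fun j _ =>
    Finset.mem_coe.2 (Finset.mem_univ (Quotient.mk r j))).symm

lemma prod_quotient_mk {M : Type*} [CommMonoid M] (r : Setoid ι) (f : Quotient r → M) :
    ∏ j, f (Quotient.mk r j) = ∏ q, f q ^ blockSize r q := by
  rw [← Finset.prod_fiberwise' Finset.univ (Quotient.mk r) f]
  exact Finset.prod_congr rfl fun q _ => by rw [Finset.prod_const, blockSize]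

/-- `Setoid.kerLift y` matches the blocks of the sample partition with the distinct symbols and
preserves counts. -/
lemma sum_observed {X : Type*} {N : ℕ} (y : Fin N → X) (f : ℕ → ℝ) :
    ∑ s ∈ observed y, f (symbolCount y s) =
      ∑ q : Quotient (Setoid.ker y), f (blockSize (Setoid.ker y) q) := by
  symm
  refine Finset.sum_nbij (Setoid.kerLift y) ?_ (Setoid.kerLift_injective y).injOn ?_ ?_
  · intro q _
    induction q using Quotient.inductionOn with
    | h j => exact Finset.mem_image_of_mem _ (Finset.mem_univ j)
  · intro s hs
    obtain ⟨j, _, rfl⟩ := Finset.mem_image.1 (Finset.mem_coe.1 hs)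
    exact ⟨Quotient.mk _ j, by simp, rfl⟩
  · intro q _
    induction q using Quotient.inductionOn with
    | h j =>
      congr 1
      unfold blockSize symbolCount
      congr 1
      ext i
      simp only [Finset.mem_filter, Finset.mem_univ, true_and]
      exact Quotient.eq

end

/-- Labellings factor uniquely into a partition and distinct labels of its blocks. -/
lemma bijective_sigma_setoid_embedding (ι κ : Type*) : Function.Bijective
    fun p : Σ r : Setoid ι, Quotient r ↪ κ => (p.2 ∘ Quotient.mk p.1 : ι → κ) := by
  constructor
  · rintro ⟨r, e⟩ ⟨r', e'⟩ h
    -- Since `e` is injective, the partition is recovered from the labelling as its kernel.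
    have hker : ∀ (r : Setoid ι) (e : Quotient r ↪ κ), Setoid.ker (e ∘ Quotient.mk r) = r := by
      intro r e
      ext i j
      rw [Setoid.ker_def, Function.comp_apply, Function.comp_apply, e.injective.eq_iff]
      exact Quotient.eq
    have h' : (e ∘ Quotient.mk r : ι → κ) = e' ∘ Quotient.mk r' := h
    have hr : r = r' := by rw [← hker r e, ← hker r' e', h']
    subst hr
    have he : e = e' := by
      ext q
      induction q using Quotient.inductionOn with
      | h j => exact congrFun h' j
    rw [he]
  · intro z
    exact ⟨⟨Setoid.ker z, ⟨Setoid.kerLift z, Setoid.kerLift_injective z⟩⟩, rfl⟩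

instance countable_setoid (N : ℕ) : Countable (Setoid (Fin N)) :=
  Function.Injective.countable (f := fun (r : Setoid (Fin N)) i j => r i j) fun r s h =>
    Setoid.ext fun i j => by rw [show r i j = s i j from congrFun (congrFun h i) j]

/-- The partition is determined by the finitely many events `y i = y j`, measurable because the
diagonal of a standard Borel space is; there are countably many partitions. -/
lemma measurable_comp_ker {X β : Type*} [MeasurableSpace X] [StandardBorelSpace X]
    [MeasurableSpace β] {N : ℕ} (g : Setoid (Fin N) → β) :
    Measurable fun y : Fin N → X => g (Setoid.ker y) := by
  let _ : MeasurableSpace (Setoid (Fin N)) := ⊤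
  refine (measurable_from_top (f := g)).comp (measurable_to_countable' fun r => ?_)
  have : (Setoid.ker ⁻¹' {r} : Set (Fin N → X)) = ⋂ i, ⋂ j, {y | y i = y j ↔ r i j} := by
    ext y
    simp only [Set.mem_preimage, Set.mem_singleton_iff, Set.mem_iInter, Set.mem_ofPred_eq]
    exact ⟨fun h i j => by rw [← h, Setoid.ker_def], fun h => Setoid.ext fun i j => h i j⟩
  rw [this]
  refine MeasurableSet.iInter fun i => MeasurableSet.iInter fun j => ?_
  have hm : MeasurableSet {y : Fin N → X | y i = y j} :=
    measurableSet_eq_fun (measurable_pi_apply i) (measurable_pi_apply j)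
  by_cases hr : r i j
  · simpa [hr] using hm
  · have hc : {y : Fin N → X | y i = y j ↔ r i j} = {y | y i = y j}ᶜ := by
      ext y
      simp [hr]
    rw [hc]
    exact hm.compl

/-- Distinct atoms make equality of symbols the same as equality of indices. This is where
non-atomicity enters. -/
lemma ae_atomLaw_ker {X ι : Type*} [MeasurableSpace X] [StandardBorelSpace X] [Countable ι]
    (ν : Measure X) [IsProbabilityMeasure ν] [NullSingletonClass ν] {N : ℕ} (z : Fin N → ι) :
    ∀ᵐ y ∂atomLaw ν z, Setoid.ker y = Setoid.ker z := by
  have hm : MeasurableSet {y : Fin N → X | Setoid.ker y = Setoid.ker z} :=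
    measurableSet_setOfPred.2 (measurable_comp_ker fun r => r = Setoid.ker z)
  rw [atomLaw, ae_map_iff (measurable_comp_index z).aemeasurable hm]
  filter_upwards [ae_injective_infinitePi (ι := ι) ν] with φ hφ
  ext i j
  simp only [Setoid.ker_def]
  exact hφ.eq_iff

section
open scoped Classical

/-- The posterior mean of the entropy as a function of the partition of the sample. -/
def partitionEntropyMean (d α : ℝ) {N : ℕ} (r : Setoid (Fin N)) : ℝ :=
  pyEntropyMean d α fun q : Quotient r => (blockSize r q : ℝ)

lemma partitionEntropyMean_ker {X : Type*} (d α : ℝ) {N : ℕ} (y : Fin N → X) :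
    partitionEntropyMean d α (Setoid.ker y) = psi0 (α + N + 1)
      - (α + (observed y).card * d) / (α + N) * psi0 (1 - d)
      - 1 / (α + N) * ∑ s ∈ observed y,
          ((symbolCount y s : ℝ) - d) * psi0 ((symbolCount y s : ℝ) - d + 1) := by
  have hsum : ∑ q : Quotient (Setoid.ker y), (blockSize (Setoid.ker y) q : ℝ) = N := by
    rw [← Nat.cast_sum, sum_blockSize, Fintype.card_fin]
  have hcard : ((observed y).card : ℝ) = Fintype.card (Quotient (Setoid.ker y)) := by
    simpa using sum_observed y fun _ => 1
  rw [partitionEntropyMean, pyEntropyMean, hsum, hcard,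
    sum_observed y fun m => ((m : ℝ) - d) * psi0 ((m : ℝ) - d + 1)]

lemma partitionEntropyMean_nonneg {d α : ℝ} (hd0 : 0 ≤ d) (hd1 : d < 1) (hα : -d < α)
    {N : ℕ} [NeZero N] (r : Setoid (Fin N)) : 0 ≤ partitionEntropyMean d α r :=
  have : Nonempty (Quotient r) := ⟨Quotient.mk r 0⟩
  (lintegral_entropyENN_mul_injSum hd0 hd1 hα
    fun q => Nat.one_le_cast.2 (one_le_blockSize r q)).1

end

section
open scoped Classical
variable {Ω X : Type*} [MeasurableSpace Ω] [MeasurableSpace X] {μ : Measure Ω}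
  [IsProbabilityMeasure μ] {ν : Measure X} [IsProbabilityMeasure ν] {N : ℕ} {d α : ℝ}
  {π : Ω → ℕ → ℝ} {φ : Ω → ℕ → X} {x : Ω → Fin N → X}

/-- Each assignment is a partition `r` followed by distinct labels `e` of its blocks. The symbol law
does not see `e`, so summing over `e` leaves a power sum with the block sizes as exponents. Given
the partition, weights and symbols thus decouple. -/
theorem IsPYSample.lintegral_mul (h : IsPYSample d α ν π φ x μ) (hd0 : 0 ≤ d) (hd1 : d < 1)
    (hα : -d < α) {g : (ℕ → ℝ) → ℝ≥0∞} (hg : Measurable g) {G : (Fin N → X) → ℝ≥0∞}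
    (hG : Measurable G) :
    ∫⁻ ω, g (π ω) * G (x ω) ∂μ = ∑' r : Setoid (Fin N),
      (∫⁻ β, g (stickBreak β) * injSum (fun j => ENNReal.ofReal (stickBreak β j))
        (fun q => (blockSize r q : ℝ)) ∂pySticks d α) * ∫⁻ y, G y ∂atomLaw ν (Quotient.mk r) := by
  have hπx : Measurable fun ω => (π ω, x ω) := h.measurable_weights.prodMk h.measurable_obs
  have hw : ∀ z : Fin N → ℕ, Measurable fun w : ℕ → ℝ => ∏ j, ENNReal.ofReal (w (z j)) :=
    fun z => Finset.measurable_prod _ fun j _ => (measurable_pi_apply _).ennreal_ofReal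
  have hprod : Measurable fun q : (ℕ → ℝ) × (Fin N → X) => g q.1 * G q.2 :=
    (hg.comp measurable_fst).mul (hG.comp measurable_snd)
  have hz : ∀ z : Fin N → ℕ, ∫⁻ q : (ℕ → ℝ) × (Fin N → X), g q.1 * G q.2 ∂(((pyMeasure d α
      ).withDensity fun w => ∏ j, ENNReal.ofReal (w (z j))).prod (atomLaw ν z)) =
      (∫⁻ β, g (stickBreak β) * ∏ j, ENNReal.ofReal (stickBreak β (z j)) ∂pySticks d α) *
        ∫⁻ y, G y ∂atomLaw ν z := by
    intro z
    have hgz : Measurable fun w : ℕ → ℝ => (∏ j, ENNReal.ofReal (w (z j))) * g w := (hw z).mul hg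
    have h1 : ∫⁻ w, g w ∂((pyMeasure d α).withDensity fun w => ∏ j, ENNReal.ofReal (w (z j))) =
        ∫⁻ w, (∏ j, ENNReal.ofReal (w (z j))) * g w ∂pyMeasure d α :=
      lintegral_withDensity_eq_lintegral_mul _ (hw z) hg
    rw [lintegral_prod_mul hg.aemeasurable hG.aemeasurable, h1, pyMeasure_eq_map,
      lintegral_map hgz measurable_stickBreak]
    simp_rw [mul_comm (g _)]
  have hmap : ∫⁻ ω, g (π ω) * G (x ω) ∂μ =
      ∫⁻ q, g q.1 * G q.2 ∂μ.map fun ω => (π ω, x ω) := (lintegral_map hprod hπx).symm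
  rw [hmap, h.map_weights_obs hd0 hd1 hα, lintegral_sum_measure]
  simp_rw [hz]
  rw [← (Equiv.ofBijective _ (bijective_sigma_setoid_embedding (Fin N) ℕ)).tsum_eq,
    ENNReal.tsum_sigma']
  refine tsum_congr fun r => ?_
  have : Countable (Quotient r ↪ ℕ) := DFunLike.coe_injective.countable
  have hcomp : ∀ e : Quotient r ↪ ℕ, ∀ β : ℕ → ℝ,
      ∏ j, ENNReal.ofReal (stickBreak β (e (Quotient.mk r j))) =
        ∏ q, ENNReal.ofReal (stickBreak β (e q)) ^ (blockSize r q : ℝ) := by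
    intro e β
    rw [prod_quotient_mk r fun q => ENNReal.ofReal (stickBreak β (e q))]
    simp_rw [ENNReal.rpow_natCast]
  have hm : ∀ e : Quotient r ↪ ℕ, Measurable fun β : ℕ → ℝ => g (stickBreak β) *
      ∏ q, ENNReal.ofReal (stickBreak β (e q)) ^ (blockSize r q : ℝ) := fun e =>
    (hg.comp measurable_stickBreak).mul (Finset.measurable_prod _ fun q _ =>
      ((measurable_pi_iff.1 measurable_stickBreak (e q)).ennreal_ofReal).pow_const _)
  simp only [Equiv.ofBijective_apply, Function.comp_apply]
  simp_rw [hcomp]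
  have hlaw : ∀ e : Quotient r ↪ ℕ, atomLaw ν (e ∘ Quotient.mk r) = atomLaw ν (Quotient.mk r) :=
    fun e => atomLaw_comp_injective ν e.injective _
  simp_rw [hlaw]
  rw [ENNReal.tsum_mul_right, ← lintegral_tsum fun e => (hm e).aemeasurable]
  simp_rw [injSum, ENNReal.tsum_mul_left]

/-- Both sides expand over partitions and agree term by term: the entropy moment of `r` is its
`pyMoment` times its `partitionEntropyMean`. -/
lemma IsPYSample.setLIntegral_entropyENN [StandardBorelSpace X] [NullSingletonClass ν] [NeZero N]
    (h : IsPYSample d α ν π φ x μ) (hd0 : 0 ≤ d) (hd1 : d < 1) (hα : -d < α)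
    {E : Set (Fin N → X)} (hE : MeasurableSet E) :
    ∫⁻ ω in x ⁻¹' E, entropyENN (π ω) ∂μ =
      ∫⁻ ω in x ⁻¹' E, ENNReal.ofReal (partitionEntropyMean d α (Setoid.ker (x ω))) ∂μ := by
  have hγ : Measurable fun y : Fin N → X =>
      ENNReal.ofReal (partitionEntropyMean d α (Setoid.ker y)) :=
    measurable_comp_ker fun r => ENNReal.ofReal (partitionEntropyMean d α r)
  have hE1 : Measurable (E.indicator (1 : (Fin N → X) → ℝ≥0∞)) := measurable_one.indicator hE
  have key1 := h.lintegral_mul hd0 hd1 hα measurable_entropyENN hE1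
  -- With the constant function `1` of the weights, the first factor reduces to the moment formula,
  -- the prior probability of the partition.
  have key2 := h.lintegral_mul hd0 hd1 hα (g := fun _ => 1) measurable_const (hγ.mul hE1)
  have hxE := h.measurable_obs hE
  have e1 : ∫⁻ ω in x ⁻¹' E, entropyENN (π ω) ∂μ =
      ∫⁻ ω, entropyENN (π ω) * E.indicator 1 (x ω) ∂μ := by
    rw [← lintegral_indicator hxE]
    refine lintegral_congr fun ω => ?_
    by_cases hω : x ω ∈ E
    · rw [Set.indicator_of_mem (show ω ∈ x ⁻¹' E from hω)]
      simp [hω]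
    · rw [Set.indicator_of_notMem (show ω ∉ x ⁻¹' E from hω)]
      simp [hω]
  have e2 : ∫⁻ ω in x ⁻¹' E, ENNReal.ofReal (partitionEntropyMean d α (Setoid.ker (x ω))) ∂μ =
      ∫⁻ ω, 1 * (ENNReal.ofReal (partitionEntropyMean d α (Setoid.ker (x ω))) *
        E.indicator 1 (x ω)) ∂μ := by
    rw [← lintegral_indicator hxE]
    refine lintegral_congr fun ω => ?_
    by_cases hω : x ω ∈ E
    · rw [Set.indicator_of_mem (show ω ∈ x ⁻¹' E from hω)]
      simp [hω]
    · rw [Set.indicator_of_notMem (show ω ∉ x ⁻¹' E from hω)]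
      simp [hω]
  rw [e1, e2, key1]
  refine Eq.trans ?_ key2.symm
  refine tsum_congr fun r => ?_
  have : Nonempty (Quotient r) := ⟨Quotient.mk r 0⟩
  have hn : ∀ q, (1 : ℝ) ≤ (blockSize r q : ℝ) := fun q =>
    Nat.one_le_cast.2 (one_le_blockSize r q)
  have hker : Setoid.ker (Quotient.mk r) = r := Setoid.ext fun i j => Quotient.eq
  have hae : ∫⁻ y, ENNReal.ofReal (partitionEntropyMean d α (Setoid.ker y)) * E.indicator 1 y
      ∂atomLaw ν (Quotient.mk r) = ENNReal.ofReal (partitionEntropyMean d α r) *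
        ∫⁻ y, E.indicator 1 y ∂atomLaw ν (Quotient.mk r) := by
    rw [← lintegral_const_mul _ hE1]
    refine lintegral_congr_ae ?_
    filter_upwards [ae_atomLaw_ker ν (Quotient.mk r)] with y hy
    rw [hy, hker]
  simp only [one_mul, Pi.mul_apply]
  rw [hae, lintegral_injSum_pySticks hd0 hd1 hn hα,
    (lintegral_entropyENN_mul_injSum hd0 hd1 hα hn).2,
    ENNReal.ofReal_mul (pyMoment_pos hd0 hd1 hα hn).le, mul_assoc]
  rfl

end

section
variable {Ω X : Type*} [MeasurableSpace Ω] [MeasurableSpace X] {μ : Measure Ω}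
  {ν : Measure X} [IsProbabilityMeasure ν] {N : ℕ} {d α : ℝ}
  {π : Ω → ℕ → ℝ} {φ : Ω → ℕ → X} {x : Ω → Fin N → X}

lemma IsPYSample.lintegral_entropyENN_ne_top (h : IsPYSample d α ν π φ x μ) (hd0 : 0 ≤ d)
    (hd1 : d < 1) (hα : -d < α) : ∫⁻ ω, entropyENN (π ω) ∂μ ≠ ∞ := by
  rw [← lintegral_map measurable_entropyENN h.measurable_weights, h.map_weights, pyMeasure_eq_map,
    lintegral_map measurable_entropyENN measurable_stickBreak,
    (lintegral_entropyENN_pySticks hd0 hd1 hα).2]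
  exact ENNReal.ofReal_ne_top

/-- The candidate is a measurable function of the sample with the right integral over every event of
the sample. Both integrands are almost surely nonnegative, so the identity of extended nonnegative
integrals suffices and also yields integrability. -/
theorem IsPYSample.condExp_entropy [IsProbabilityMeasure μ] [StandardBorelSpace X]
    [NullSingletonClass ν] [NeZero N] (h : IsPYSample d α ν π φ x μ) (hd0 : 0 ≤ d) (hd1 : d < 1)
    (hα : -d < α) :
    μ[fun ω => entropy (π ω) | MeasurableSpace.comap x inferInstance] =ᵐ[μ]
      fun ω => partitionEntropyMean d α (Setoid.ker (x ω)) := by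
  have hfin := h.lintegral_entropyENN_ne_top hd0 hd1 hα
  have h01 := h.ae_weights_mem_Icc hd0 hd1 hα
  have hγ : Measurable fun y : Fin N → X => partitionEntropyMean d α (Setoid.ker y) :=
    measurable_comp_ker fun r => partitionEntropyMean d α r
  have hγx : Measurable fun ω => partitionEntropyMean d α (Setoid.ker (x ω)) :=
    hγ.comp h.measurable_obs
  have hγ0 : ∀ ω, 0 ≤ partitionEntropyMean d α (Setoid.ker (x ω)) := fun ω =>
    partitionEntropyMean_nonneg hd0 hd1 hα _
  have hset : ∀ E, MeasurableSet E →
      ∫⁻ ω in x ⁻¹' E, ENNReal.ofReal (partitionEntropyMean d α (Setoid.ker (x ω))) ∂μ =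
        ∫⁻ ω in x ⁻¹' E, entropyENN (π ω) ∂μ := fun E hE =>
    (h.setLIntegral_entropyENN hd0 hd1 hα hE).symm
  have hγint : Integrable (fun ω => partitionEntropyMean d α (Setoid.ker (x ω))) μ := by
    refine ⟨hγx.aestronglyMeasurable, ?_⟩
    rw [hasFiniteIntegral_iff_ofReal (ae_of_all _ hγ0)]
    have := hset Set.univ MeasurableSet.univ
    rw [Set.preimage_univ, Measure.restrict_univ] at this
    rw [this]
    exact hfin.lt_top
  refine (ae_eq_condExp_of_forall_setIntegral_eq h.measurable_obs.comap_le
    (integrable_entropy h.measurable_weights h01 hfin) (fun s _ _ => hγint.integrableOn) ?_ ?_).symm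
  · rintro s ⟨E, hE, rfl⟩ -
    rw [integral_eq_lintegral_of_nonneg_ae (ae_of_all _ hγ0) hγx.aestronglyMeasurable, hset E hE,
      integral_entropy h.measurable_weights (ae_restrict_of_ae h01)
        (ne_top_of_le_ne_top hfin (setLIntegral_le_lintegral _ _))]
  · exact (hγ.comp (comap_measurable x)).aestronglyMeasurable

end

end

/-! ### The posterior mean entropy, from the sample and from the posterior vector -/

theorem mainTheorem4 (d α : ℝ) (hd0 : 0 ≤ d) (hd1 : d < 1) (hα : -d < α) :
    -- the posterior mean of the entropy, given the observed sample
    (∀ {Ω X : Type*} [MeasurableSpace Ω] [MeasurableSpace X] [StandardBorelSpace X]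
      (μ : Measure Ω) [IsProbabilityMeasure μ]
      (ν : Measure X) [IsProbabilityMeasure ν] [NullSingletonClass ν]
      (N : ℕ) (_ : 1 ≤ N) (π : Ω → ℕ → ℝ) (φ : Ω → ℕ → X) (x : Ω → Fin N → X),
      IsPYSample d α ν π φ x μ →
        (∀ᵐ ω ∂μ, Summable fun i => Real.negMulLog (π ω i)) ∧
        Integrable (fun ω => entropy (π ω)) μ ∧
        μ[fun ω => entropy (π ω) | MeasurableSpace.comap x inferInstance] =ᵐ[μ] fun ω =>
          psi0 (α + N + 1)
            - (α + (observed (x ω)).card * d) / (α + N) * psi0 (1 - d)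
            - 1 / (α + N) * ∑ s ∈ observed (x ω),
                ((symbolCount (x ω) s : ℝ) - d) * psi0 ((symbolCount (x ω) s : ℝ) - d + 1)) ∧
    -- the mean entropy of the random vector `(p_1, …, p_K, p_* π)` with given counts
    (∀ (K N : ℕ) (_ : 1 ≤ K) (n : Fin K → ℕ) (_ : ∀ i, 1 ≤ n i) (_ : ∑ i, n i = N),
        (∀ᵐ π ∂(pyPosterior d α n), Summable fun i => Real.negMulLog (π i)) ∧
        Integrable entropy (pyPosterior d α n) ∧
        ∫ π, entropy π ∂(pyPosterior d α n) =
          psi0 (α + N + 1)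
            - (α + K * d) / (α + N) * psi0 (1 - d)
            - 1 / (α + N) * ∑ i, ((n i : ℝ) - d) * psi0 ((n i : ℝ) - d + 1)) := by
  refine ⟨?_, ?_⟩
  · intro Ω X _ _ _ μ _ ν _ _ N hN π φ x h
    have : NeZero N := ⟨by omega⟩
    have hfin := h.lintegral_entropyENN_ne_top hd0 hd1 hα
    have h01 := h.ae_weights_mem_Icc hd0 hd1 hα
    refine ⟨ae_summable_negMulLog h.measurable_weights h01 hfin,
      integrable_entropy h.measurable_weights h01 hfin, ?_⟩
    filter_upwards [h.condExp_entropy hd0 hd1 hα] with ω hω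
    rw [hω, partitionEntropyMean_ker]
  · intro K N hK n hn hsum
    obtain ⟨h0, h01, hlint⟩ := lintegral_entropyENN_pyPosterior hd0 hd1 hα hK hn
    have hfin : ∫⁻ w, entropyENN w ∂pyPosterior d α n ≠ ⊤ := by
      rw [hlint]
      exact ENNReal.ofReal_ne_top
    refine ⟨ae_summable_negMulLog measurable_id h01 hfin,
      integrable_entropy measurable_id h01 hfin, ?_⟩
    have hN : ∑ i, (n i : ℝ) = N := by rw [← hsum, Nat.cast_sum]
    refine (integral_entropy measurable_id h01 hfin).trans ?_
    simp only [id]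
    rw [hlint, ENNReal.toReal_ofReal h0, pyEntropyMean, hN, Fintype.card_fin]
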